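/- **Theorem.** Let $(X_n,d_n)_{n\in\mathbb Z}$ be non-empty compact metric spaces, $T_n\colon X_n\to X_{n+1}$ continuous maps and $\varphi_n\colon X_n\to\mathbb R$ continuous functions. Write $\mathbf T_n^k=T_{n+k-1}\circ\dots\circ T_n$ and let $B(x,\delta)$ be the open ball. Assume that there are constants $D\in\mathbb N$, $\delta>0$, $\rho\in(0,1)$, an integer $\tau\ge1$, and $H,\beta,V>0$ such that for all $n\in\mathbb Z$: * (A1) $\#T_n^{-1}(x)\le D$ for every $x\in X_{n+1}$; * (A2) $d_n(x,x')\le\rho\,d_{n+1}(T_nx,T_nx')$ whenever $x,x'\in X_n$ and $d_n(x,x')\le\delta$, and $T_n(B(x,\delta))\supset B(T_nx,\delta)$ for every $x\in X_n$; * (A3) $\mathbf T_n^\tau(B(x,\delta))=X_{n+\tau}$ for every $x\in X_n$; * (A4) $|\varphi_n(x)-\varphi_n(x')|\le H\,d_n(x,x')^\beta$ whenever $d_n(x,x')\le\delta$, and $\sup\varphi_n-\inf\varphi_n\le V$. Let $L_n\colon C(X_n)\to C(X_{n+1})$, $(L_nf)(x)=\sum_{y\in T_n^{-1}(x)}e^{\varphi_n(y)}f(y)$,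 and $\mathbf L_n^k=L_{n+k-1}\circ\dots\circ L_n$. Let $M(X_n)$ be the set of nonzero finite positive Borel measures on $X_n$, $\langle f,m\rangle=\int f\,dm$, and let $L_n^*$, $(\mathbf L_n^k)^*$ be the dual operators on measures, $\langle f,L_n^*m\rangle=\langle L_nf,m\rangle$. Let $\|\cdot\|$ be the uniform norm, $\mathbb 1$ the constant function $1$, and for $Q>0$ let $$\Lambda_n(Q)=\{f\in C(X_n): f\ge0,\ f\not\equiv0,\ f(x)\le e^{Q d_n(x,x')^\beta}f(x')\text{ whenever }d_n(x,x')\le\delta\}.$$ Then there is $Q_0>0$ such that for every $Q\ge Q_0$, with $\Lambda_n=\Lambda_n(Q)$, there are $\lambda_n\in\mathbb R$, finite Borel measures $m_n$ on $X_n$ and $h_n\in C(X_n)$ ($n\in\mathbb Z$) such that, writing $\boldsymbol\lambda_n^k=\prod_{j=0}^{k-1}\lambda_{n+j}$, the following hold. * **[A]** For every $n\in\mathbb Z$ and all $\sigma_\ell\in M(X_\ell)$, $\ell\ge n$, $$\lambda_n=\lim_{k\to\infty}\frac{\langle\mathbf L_n^k\mathbb 1,\sigma_{n+k}\rangle}{\langle\mathbf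 L_{n+1}^{k-1}\mathbb 1,\sigma_{n+k}\rangle},\qquad m_n=\lim_{k\to\infty}\frac{(\mathbf L_n^k)^*\sigma_{n+k}}{\langle\mathbb 1,(\mathbf L_n^k)^*\sigma_{n+k}\rangle}\ \text{ (weak* limit)}.$$ * **[B]** For every $n\in\mathbb Z$: $\lambda_n>0$, $m_n$ is a probability measure, and $L_n^*m_{n+1}=\lambda_nm_n$. * **[C]** For every $N\in\mathbb Z$, $(m_n)_{n\ge N}$ is the unique sequence of Borel probability measures on the $X_n$, $n\ge N$, such that $L_n^*m_{n+1}$ is a scalar multiple of $m_n$ for every $n\ge N$; in particular $(m_n)_{n\in\mathbb Z}$ is the unique two-sided sequence with this property. * **[D]** There are $C_1,C_2>0$ and $\gamma\in(0,1)$ such that for all $n\in\mathbb Z$, $k\ge\tau$, $\sigma\in M(X_{n+k})$ and $f\in\Lambda_n$, $$\Big|\log\lambda_n-\log\frac{\langle\mathbf L_n^k\mathbb 1,\sigma\rangle}{\langle\mathbf L_{n+1}^{k-1}\mathbb 1,\sigma\rangle}\Big|\le C_1\gamma^k,\qquad\Big|\langle f,m_n\rangle-\frac{\langle f,(\mathbf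 L_n^k)^*\sigma\rangle}{\langle\mathbb 1,(\mathbf L_n^k)^*\sigma\rangle}\Big|\le C_2\|f\|\gamma^k.$$ * **[E]** For every $n\in\mathbb Z$ and all $f_\ell\in\Lambda_\ell$, $\ell\le n$, in the uniform norm, $$h_n=\lim_{k\to\infty}\frac{\mathbf L_{n-k}^kf_{n-k}}{\boldsymbol\lambda_{n-k}^k\langle f_{n-k},m_{n-k}\rangle}.$$ * **[F]** For every $n\in\mathbb Z$, $h_n$ is strictly positive, lies in $\Lambda_n$, and satisfies $\int h_n\,dm_n=1$ and $L_nh_n=\lambda_nh_{n+1}$. * **[G]** $(h_n)_{n\in\mathbb Z}$ is the unique sequence of functions $h_n\in\Lambda_n$ such that $\int h_n\,dm_n=1$ and $L_nh_n$ is a scalar multiple of $h_{n+1}$ for all $n\in\mathbb Z$. * **[H]** There are $C_3>0$ and $\gamma\in(0,1)$ such that for all $n\in\mathbb Z$, $k\ge\tau$ and $f\in\Lambda_{n-k}$, $$\Big\|h_n-\frac{\mathbf L_{n-k}^kf}{\boldsymbol\lambda_{n-k}^k\langle f,m_{n-k}\rangle}\Big\|\le C_3\gamma^k.$$ -/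

import Mathlib

open Filter Topology MeasureTheory
open scoped NNReal

namespace NonstatRPF

universe u

section Hypotheses

variable {X : ℤ → Type u}

/-- The `k`-fold composition `T_{n+k-1} ∘ ⋯ ∘ T_n : X_n → X_m`, where `m = n + k`.
The target index is a separate argument with a proof of `n + k = m`, so that no
transport along equalities of integers is visible at the places of use. -/
def iterMap (T : ∀ n, X n → X (n + 1)) : (k : ℕ) → (n m : ℤ) → n + (k : ℤ) = m → X n → X m
  | 0, _, _, h => cast (congrArg X (by simpa using h))
  | k + 1, n, m, h => fun x =>
      iterMap T k (n + 1) m (by rw [← h]; push_cast; ring) (T n x)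

variable [∀ n, MetricSpace (X n)]

/-- The standing conditions on a two-sided sequence of (compact) metric spaces `X n`, maps
`T n : X n → X (n + 1)` and continuous potentials `φ n`. -/
structure UniformlyExpanding (T : ∀ n, X n → X (n + 1)) (φ : ∀ n, C(X n, ℝ))
    (D : ℕ) (δ ρ : ℝ) (τ : ℕ) (H β V : ℝ) : Prop where
  /-- every map is continuous -/
  continuous : ∀ n, Continuous (T n)
  /-- every point has at most `D` preimages -/
  encard_preimage_le : ∀ n (x : X (n + 1)), (T n ⁻¹' {x}).encard ≤ D
  delta_pos : 0 < δ
  rho_pos : 0 < ρ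
  rho_lt_one : ρ < 1
  /-- uniform expansion at scale `δ` -/
  expanding : ∀ n (x x' : X n), dist x x' ≤ δ → dist x x' ≤ ρ * dist (T n x) (T n x')
  /-- locally onto at scale `δ` -/
  locally_onto : ∀ n (x : X n), Metric.ball (T n x) δ ⊆ T n '' Metric.ball x δ
  tau_pos : 0 < τ
  /-- uniform topological exactness -/
  exact : ∀ n (x : X n), iterMap T τ n (n + τ) rfl '' Metric.ball x δ = Set.univ
  holder_const_pos : 0 < H
  holder_exp_pos : 0 < β
  /-- uniform Hölder continuity of the potentials at scale `δ` -/
  holder : ∀ n (x x' : X n), dist x x' ≤ δ → |φ n x - φ n x'| ≤ H * dist x x' ^ β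
  osc_pos : 0 < V
  /-- uniformly bounded oscillation of the potentials -/
  osc_le : ∀ n, (⨆ x, φ n x) - (⨅ x, φ n x) ≤ V

/-- The function `x ↦ ∑_{y ∈ T_n⁻¹(x)} e^{φ_n(y)} f(y)` on `X (n + 1)`. -/
noncomputable def transfer (T : ∀ n, X n → X (n + 1)) (φ : ∀ n, C(X n, ℝ)) (n : ℤ)
    (f : X n → ℝ) (x : X (n + 1)) : ℝ :=
  ∑ᶠ y ∈ T n ⁻¹' {x}, Real.exp (φ n y) * f y

/-- The cone `Λ_n(Q)`. -/
def rpfCone (X : ℤ → Type u) [∀ n, MetricSpace (X n)] (δ β Q : ℝ) (n : ℤ) : Set C(X n, ℝ) :=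
  {f | 0 ≤ f ∧ f ≠ 0 ∧
    ∀ x x' : X n, dist x x' ≤ δ → f x ≤ Real.exp (Q * dist x x' ^ β) * f x'}

variable {T : ∀ n, X n → X (n + 1)} {φ : ∀ n, C(X n, ℝ)}
  {D : ℕ} {δ ρ : ℝ} {τ : ℕ} {H β V : ℝ}

theorem UniformlyExpanding.finite_preimage (h : UniformlyExpanding T φ D δ ρ τ H β V)
    (n : ℤ) (x : X (n + 1)) : (T n ⁻¹' {x}).Finite :=
  Set.finite_of_encard_le_coe (h.encard_preimage_le n x)

theorem UniformlyExpanding.continuous_transfer (h : UniformlyExpanding T φ D δ ρ τ H β V)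
    (n : ℤ) (f : C(X n, ℝ)) : Continuous (transfer T φ n f) := by
  classical
  have hδ := h.delta_pos
  have lift : ∀ (y : X n) (x' : X (n + 1)), ∃ y', x' ∈ Metric.ball (T n y) δ →
      T n y' = x' ∧ dist y y' ≤ ρ * dist (T n y) x' := by
    intro y x'
    by_cases hx : x' ∈ Metric.ball (T n y) δ
    · obtain ⟨y', hy', hT⟩ := h.locally_onto n y hx
      refine ⟨y', fun _ => ⟨hT, ?_⟩⟩
      have := h.expanding n y y' (by rw [dist_comm]; exact (Metric.mem_ball.1 hy').le)
      rwa [hT] at this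
    · exact ⟨y, fun h' => absurd h' hx⟩
  choose g hg using lift
  rw [continuous_iff_continuousAt]
  intro x
  have hfin := h.finite_preimage n x
  -- two lifts that are close to each other coincide
  have uniq : ∀ (z : X (n + 1)) (a b c : X n), T n a = z → T n b = z → ∀ r, r < δ / 2 →
      dist c a ≤ ρ * r → dist c b ≤ ρ * r → 0 ≤ r → a = b := by
    intro z a b c ha hb r hr h1 h2 hr0
    have hρr : ρ * r ≤ r := by nlinarith [h.rho_lt_one]
    have hab : dist a b ≤ δ := by
      have := dist_triangle_left a b c
      linarith
    have := h.expanding n a b hab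
    rw [ha, hb, dist_self, mul_zero] at this
    exact dist_le_zero.1 this
  have key : ∀ x' ∈ Metric.ball x (δ / 2), transfer T φ n f x' =
      ∑ y ∈ hfin.toFinset, Real.exp (φ n (g y x')) * f (g y x') := by
    intro x' hx'
    have hx1 : dist x' x < δ / 2 := hx'
    have hx2 : dist x x' < δ / 2 := by rw [dist_comm]; exact hx'
    have gS : ∀ y, T n y = x → T n (g y x') = x' ∧ dist y (g y x') ≤ ρ * dist x x' := by
      intro y hy
      have := hg y x' (by rw [Metric.mem_ball, hy]; linarith)
      rwa [hy] at this
    have himg : T n ⁻¹' {x'} = (fun y => g y x') '' (T n ⁻¹' {x}) := by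
      ext y'
      constructor
      · intro hy'
        have hy' : T n y' = x' := hy'
        have h1 := hg y' x (by rw [Metric.mem_ball, hy']; linarith)
        rw [hy', dist_comm x' x] at h1
        refine ⟨g y' x, h1.1, ?_⟩
        have h2 := gS _ h1.1
        exact uniq x' _ _ (g y' x) h2.1 hy' _ hx2 h2.2
          (by rw [dist_comm]; exact h1.2) dist_nonneg
      · rintro ⟨y, hy, rfl⟩
        exact (gS y hy).1
    have hinj : Set.InjOn (fun y => g y x') (T n ⁻¹' {x}) := by
      intro a ha b hb hab
      have hab : g a x' = g b x' := hab
      have h1 := gS a ha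
      have h2 := gS b hb
      exact uniq x a b (g a x') ha hb _ hx2 (by rw [dist_comm]; exact h1.2)
        (by rw [hab, dist_comm]; exact h2.2) dist_nonneg
    unfold transfer
    rw [himg, finsum_mem_image hinj, finsum_mem_eq_finite_toFinset_sum _ hfin]
  have hgx : ∀ y ∈ hfin.toFinset, Tendsto (fun x' => g y x') (𝓝 x) (𝓝 y) := by
    intro y hy
    have hy : T n y = x := by simpa using hy
    rw [tendsto_iff_dist_tendsto_zero]
    have hb : ∀ᶠ x' in 𝓝 x, dist (g y x') y ≤ ρ * dist x x' := by
      filter_upwards [Metric.ball_mem_nhds x hδ] with x' hx'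
      have := (hg y x' (by rw [hy]; exact hx')).2
      rwa [hy, dist_comm y] at this
    refine squeeze_zero' (Eventually.of_forall fun _ => dist_nonneg) hb ?_
    have : Tendsto (fun x' => ρ * dist x x') (𝓝 x) (𝓝 (ρ * dist x x)) :=
      (Continuous.tendsto (by fun_prop) x)
    simpa using this
  have hlim : Tendsto (fun x' => ∑ y ∈ hfin.toFinset,
      Real.exp (φ n (g y x')) * f (g y x')) (𝓝 x)
      (𝓝 (∑ y ∈ hfin.toFinset, Real.exp (φ n y) * f y)) := by
    refine tendsto_finsetSum _ fun y hy => ?_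
    have hc : Continuous fun z => Real.exp (φ n z) * f z := by fun_prop
    exact (hc.tendsto y).comp (hgx y hy)
  have hval : transfer T φ n f x = ∑ y ∈ hfin.toFinset, Real.exp (φ n y) * f y := by
    unfold transfer
    rw [finsum_mem_eq_finite_toFinset_sum _ hfin]
  unfold ContinuousAt
  rw [hval]
  refine hlim.congr' ?_
  filter_upwards [Metric.ball_mem_nhds x (half_pos hδ)] with x' hx'
  exact (key x' hx').symm

/-- The Ruelle–Perron–Frobenius operator `L_n : C(X_n) → C(X_{n+1})`, a positive linear map. -/
noncomputable def rpf (h : UniformlyExpanding T φ D δ ρ τ H β V) (n : ℤ) :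
    C(X n, ℝ) →ₚ[ℝ] C(X (n + 1), ℝ) :=
  PositiveLinearMap.mk₀
    { toFun := fun f => ⟨transfer T φ n f, h.continuous_transfer n f⟩
      map_add' := fun f g => by
        ext x
        simp only [ContinuousMap.coe_mk, ContinuousMap.add_apply, transfer, mul_add]
        exact finsum_mem_add_distrib (h.finite_preimage n x)
      map_smul' := fun c f => by
        ext x
        have hf := h.finite_preimage n x
        simp only [ContinuousMap.coe_mk, ContinuousMap.smul_apply, transfer, smul_eq_mul,
          RingHom.id_apply]
        rw [finsum_mem_eq_finite_toFinset_sum _ hf, finsum_mem_eq_finite_toFinset_sum _ hf,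
          Finset.mul_sum]
        exact Finset.sum_congr rfl fun y _ => by ring }
    (fun f hf x => finsum_nonneg fun y => finsum_nonneg fun _ =>
      mul_nonneg (Real.exp_pos _).le (hf y))

/-- The composition `L_{n+k-1} ∘ ⋯ ∘ L_n : C(X_n) → C(X_m)`, where `m = n + k`. -/
noncomputable def iterRpf (h : UniformlyExpanding T φ D δ ρ τ H β V) :
    (k : ℕ) → (n m : ℤ) → n + (k : ℤ) = m → C(X n, ℝ) →ₚ[ℝ] C(X m, ℝ)
  | 0, n, m, e =>
      have e' : n = m := by simpa using e
      e' ▸ PositiveLinearMap.id ℝ C(X n, ℝ)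
  | k + 1, n, m, e =>
      (iterRpf h k (n + 1) m (by rw [← e]; push_cast; ring)).comp (rpf h n)

end Hypotheses

section Dual

/-- The positive functional `f ↦ ∫ L f dσ` on the continuous functions on a compact space. -/
noncomputable def dualFunctional {Y Z : Type*} [MetricSpace Y]
    [MetricSpace Z] [CompactSpace Z] [MeasurableSpace Z] [BorelSpace Z]
    (L : C(Y, ℝ) →ₚ[ℝ] C(Z, ℝ)) (σ : FiniteMeasure Z) :
    CompactlySupportedContinuousMap Y ℝ →ₚ[ℝ] ℝ :=
  PositiveLinearMap.mk₀
    { toFun := fun f => ∫ z, L (f : C(Y, ℝ)) z ∂(σ : Measure Z)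
      map_add' := fun f g => by
        have hi : ∀ u : C(Z, ℝ), Integrable u (σ : Measure Z) := fun u =>
          u.continuous.integrable_of_hasCompactSupport (HasCompactSupport.of_compactSpace u)
        have : ((f + g : CompactlySupportedContinuousMap Y ℝ) : C(Y, ℝ))
          = (f : C(Y, ℝ)) + (g : C(Y, ℝ)) := rfl
        rw [this, map_add]
        exact integral_add (hi _) (hi _)
      map_smul' := fun c f => by
        have : ((c • f : CompactlySupportedContinuousMap Y ℝ) : C(Y, ℝ))
          = c • (f : C(Y, ℝ)) := rfl
        rw [this, map_smul]
        exact integral_const_mul _ _ }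
    (fun f hf => integral_nonneg fun z =>
      (map_nonneg L (show (0 : C(Y, ℝ)) ≤ (f : C(Y, ℝ)) from fun y => hf y)) z)

/-- The dual operator `L^* : M(Z) → M(Y)` of a positive linear map `L : C(Y) → C(Z)`, given by
the Riesz representation theorem. -/
noncomputable def dualMeasure {Y Z : Type*} [MetricSpace Y] [CompactSpace Y] [MeasurableSpace Y]
    [BorelSpace Y] [MetricSpace Z] [CompactSpace Z] [MeasurableSpace Z] [BorelSpace Z]
    (L : C(Y, ℝ) →ₚ[ℝ] C(Z, ℝ)) (σ : FiniteMeasure Z) : FiniteMeasure Y :=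
  ⟨RealRMK.rieszMeasure (dualFunctional L σ), inferInstance⟩

/-- The integral of a continuous function against a finite measure. -/
noncomputable def pairing {Y : Type*} [TopologicalSpace Y] [MeasurableSpace Y]
    (f : C(Y, ℝ)) (σ : FiniteMeasure Y) : ℝ :=
  ∫ y, f y ∂(σ : Measure Y)

/-- The defining property of the dual operator: `⟨f, L^* σ⟩ = ⟨L f, σ⟩`. -/
theorem pairing_dualMeasure {Y Z : Type*} [MetricSpace Y] [CompactSpace Y] [MeasurableSpace Y]
    [BorelSpace Y] [MetricSpace Z] [CompactSpace Z] [MeasurableSpace Z] [BorelSpace Z]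
    (L : C(Y, ℝ) →ₚ[ℝ] C(Z, ℝ)) (σ : FiniteMeasure Z) (f : C(Y, ℝ)) :
    pairing f (dualMeasure L σ) = pairing (L f) σ :=
  RealRMK.integral_rieszMeasure (dualFunctional L σ)
    (CompactlySupportedContinuousMap.continuousMapEquiv f)

end Dual

end NonstatRPF

open NonstatRPF

set_option linter.unusedSectionVars false

namespace NonstatRPF

/-! ### Cocycle identities, surjectivity and exactness at small scales. -/

section Iterates

variable {X : ℤ → Type*} {T : ∀ n, X n → X (n + 1)}

/-! The transfer operators contract cones of nonnegative functions whose logarithm has controlled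
Hölder oscillation; a quantitative form of this contraction gives everything. Inverse branches
contract by `ρ`, so the cone with constant `Q` goes into the one with constant `θ * Q`
(`rpf_mem_localCone`), and exactness after `N` steps bounds the distortion of images by a constant
`K` (`ContractionData.iterRpf_le_mul`). Hence an image dominates, in the order of the cone, a
definite multiple of any other image of comparable size (`sub_smul_mem_localCone`). If `f - a • g`
and `b • g - f` lie in the cone, they add up to `(b - a) • g`, so at a given point one of their
images is at least half the image of the sum; the corresponding endpoint can be moved, and `b - a`
shrinks by a fixed factor every `N` steps. This replaces Hilbert's projective metric and yields
`ContractionData.exists_sandwich`: pointwise, `L^k f` lies between `a * L^k g` and `(a + C * B * γ ^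
k) * L^k g`.

Eigenmeasures. By compactness each space carries a probability measure that is nonnegative on every
continuous function with a nonnegative forward iterate. The sandwich with `g = 1` makes it unique
(`IsDualPositive.eq`). The property is preserved by the normalised dual operators, so uniqueness
alone gives the eigenmeasure equation, and also uniqueness along half-lines. Testing the sandwich
against an arbitrary measure and against the eigenmeasure gives the forward rates.

Eigenfunctions. Iterates normalised to have integral one against the eigenmeasures forget their
starting function exponentially fast (`ConformalFamily.exists_unitize_rate`). Thus the normalised
iterates of `1` from the remote past are Cauchy, and their limits are eigenfunctions. Any normalised
family in the cones that is invariant up to scalars is the limit of all such iterates, which gives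
uniqueness.

The working cones live at scale `δ / 2`, where lifts along inverse branches are unique, and measures
are handled with exponent `min β 1`, for which the cone spans all Lipschitz functions. The theorem's
cones embed in these, and `Q₀` is taken large enough that the eigenfunctions return to the theorem's
cones. -/

theorem iterMap_zero (n : ℤ) (e : n + ((0 : ℕ) : ℤ) = n) (x : X n) : iterMap T 0 n n e x = x :=
  rfl

theorem iterMap_add (j k p : ℕ) (hp : p = j + k) (n l m : ℤ) (e₁ : n + (j : ℤ) = l)
    (e₂ : l + (k : ℤ) = m) (e : n + (p : ℤ) = m) (x : X n) :
    iterMap T p n m e x = iterMap T k l m e₂ (iterMap T j n l e₁ x) := by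
  induction j generalizing p n with
  | zero =>
    obtain rfl : p = k := by omega
    obtain rfl : n = l := by simpa using e₁
    rfl
  | succ j ih =>
    obtain ⟨q, rfl⟩ : ∃ q, p = q + 1 := ⟨j + k, by omega⟩
    exact ih q (by omega) (n + 1) (by rw [← e₁]; push_cast; ring)
      (by rw [← e]; push_cast; ring) (T n x)

variable [∀ n, MetricSpace (X n)] {φ : ∀ n, C(X n, ℝ)}
  {D : ℕ} {δ ρ : ℝ} {τ : ℕ} {H β V : ℝ} (hA : UniformlyExpanding T φ D δ ρ τ H β V)

theorem iterRpf_zero (n : ℤ) (e : n + ((0 : ℕ) : ℤ) = n) (f : C(X n, ℝ)) :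
    iterRpf hA 0 n n e f = f :=
  rfl

theorem iterRpf_succ (k : ℕ) (n m : ℤ) (e : n + ((k + 1 : ℕ) : ℤ) = m)
    (e' : n + 1 + (k : ℤ) = m) (f : C(X n, ℝ)) :
    iterRpf hA (k + 1) n m e f = iterRpf hA k (n + 1) m e' (rpf hA n f) :=
  rfl

theorem iterRpf_add (j k p : ℕ) (hp : p = j + k) (n l m : ℤ) (e₁ : n + (j : ℤ) = l)
    (e₂ : l + (k : ℤ) = m) (e : n + (p : ℤ) = m) (f : C(X n, ℝ)) :
    iterRpf hA p n m e f = iterRpf hA k l m e₂ (iterRpf hA j n l e₁ f) := by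
  induction j generalizing p n with
  | zero =>
    obtain rfl : p = k := by omega
    obtain rfl : n = l := by simpa using e₁
    rfl
  | succ j ih =>
    obtain ⟨q, rfl⟩ : ∃ q, p = q + 1 := ⟨j + k, by omega⟩
    exact ih q (by omega) (n + 1) (by rw [← e₁]; push_cast; ring)
      (by rw [← e]; push_cast; ring) (rpf hA n f)

theorem iterRpf_succ' (k : ℕ) (n m : ℤ) (e : n + ((k + 1 : ℕ) : ℤ) = m + 1)
    (e' : n + (k : ℤ) = m) (f : C(X n, ℝ)) :
    iterRpf hA (k + 1) n (m + 1) e f = rpf hA m (iterRpf hA k n m e' f) :=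
  iterRpf_add hA k 1 (k + 1) rfl n m (m + 1) e' (by simp) e f

theorem rpf_apply (n : ℤ) (f : C(X n, ℝ)) (x : X (n + 1)) :
    rpf hA n f x = ∑ y ∈ (hA.finite_preimage n x).toFinset, Real.exp (φ n y) * f y :=
  finsum_mem_eq_finite_toFinset_sum _ (hA.finite_preimage n x)

include hA in
theorem UniformlyExpanding.card_preimage_le (n : ℤ) (x : X (n + 1)) :
    (hA.finite_preimage n x).toFinset.card ≤ D := by
  have := hA.encard_preimage_le n x
  rw [(hA.finite_preimage n x).encard_eq_coe_toFinset_card] at this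
  exact_mod_cast this

include hA in
theorem UniformlyExpanding.image_iterMap_ball {n m : ℤ} (e : n + (τ : ℤ) = m) (x : X n) :
    iterMap T τ n m e '' Metric.ball x δ = Set.univ := by
  subst e
  exact hA.exact n x

include hA in
-- Start the exactness condition `τ - 1` levels before `n`: then `T n` is the last map of a
-- surjective composition.
theorem UniformlyExpanding.surjective [∀ n, Nonempty (X n)] (n : ℤ) :
    Function.Surjective (T n) := by
  intro y
  obtain ⟨t, rfl⟩ : ∃ t, τ = t + 1 := ⟨τ - 1, by have := hA.tau_pos; omega⟩
  obtain ⟨x⟩ : Nonempty (X (n - t)) := inferInstance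
  have e : n - (t : ℤ) + ((t + 1 : ℕ) : ℤ) = n + 1 := by push_cast; ring
  have hy : y ∈ iterMap T (t + 1) (n - t) (n + 1) e '' Metric.ball x δ := by
    rw [hA.image_iterMap_ball e x]; trivial
  obtain ⟨z, -, rfl⟩ := hy
  exact ⟨iterMap T t (n - t) n (by ring) z,
    (iterMap_add t 1 (t + 1) rfl (n - t) n (n + 1) (by ring) (by simp) e z).symm⟩

include hA in
theorem UniformlyExpanding.iterMap_surjective [∀ n, Nonempty (X n)] (k : ℕ) (n m : ℤ)
    (e : n + (k : ℤ) = m) : Function.Surjective (iterMap T k n m e) := by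
  induction k generalizing n with
  | zero =>
    obtain rfl : n = m := by simpa using e
    exact fun y => ⟨y, rfl⟩
  | succ k ih => exact (ih (n + 1) (by rw [← e]; push_cast; ring)).comp (hA.surjective n)

include hA in
theorem UniformlyExpanding.one_le_card [∀ n, Nonempty (X n)] : (1 : ℝ) ≤ D := by
  obtain ⟨x⟩ : Nonempty (X (0 + 1)) := inferInstance
  obtain ⟨y, hy⟩ := hA.surjective 0 x
  have h1 := hA.card_preimage_le 0 x
  have h2 : 0 < (hA.finite_preimage 0 x).toFinset.card :=
    Finset.card_pos.2 ⟨y, by simpa using hy⟩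
  exact_mod_cast h2.trans_le h1

include hA in
-- Once a ball covers the whole space it keeps doing so, because the later maps are surjective.
theorem UniformlyExpanding.image_iterMap_eq_univ [∀ n, Nonempty (X n)] {j k : ℕ} (hjk : j ≤ k)
    {s : ℝ} (h : ∀ (n m : ℤ) (e : n + (j : ℤ) = m) (x : X n),
      iterMap T j n m e '' Metric.ball x s = Set.univ)
    {n m : ℤ} (e : n + (k : ℤ) = m) (x : X n) :
    iterMap T k n m e '' Metric.ball x s = Set.univ := by
  refine Set.eq_univ_of_forall fun z => ?_
  obtain ⟨i, rfl⟩ := Nat.exists_eq_add_of_le hjk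
  have e₂ : n + (j : ℤ) + (i : ℤ) = m := by rw [← e]; push_cast; ring
  obtain ⟨w, rfl⟩ := hA.iterMap_surjective i (n + j) m e₂ z
  have hw : w ∈ iterMap T j n (n + j) rfl '' Metric.ball x s := by rw [h]; trivial
  obtain ⟨y, hy, rfl⟩ := hw
  exact ⟨y, hy, iterMap_add j i (j + i) rfl n (n + j) m rfl e₂ e y⟩

include hA in
theorem UniformlyExpanding.exists_lift {n : ℤ} {y : X n} {x' : X (n + 1)}
    (hx : dist (T n y) x' < δ) : ∃ y', T n y' = x' ∧ dist y y' ≤ ρ * dist (T n y) x' := by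
  obtain ⟨y', hy', rfl⟩ := hA.locally_onto n y (by rwa [Metric.mem_ball, dist_comm])
  exact ⟨y', rfl, hA.expanding n y y' (by rw [dist_comm]; exact (Metric.mem_ball.1 hy').le)⟩

include hA in
-- Points are lifted one map at a time, the distance to the reference orbit shrinking by `ρ` at each
-- lift.
theorem UniformlyExpanding.ball_subset_image_iterMap (k : ℕ) (n m : ℤ) (e : n + (k : ℤ) = m)
    (x : X n) : Metric.ball (iterMap T k n m e x) δ ⊆
      iterMap T k n m e '' Metric.ball x (ρ ^ k * δ) := by
  have hδ := hA.delta_pos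
  have hρ := hA.rho_pos
  induction k generalizing n with
  | zero =>
    obtain rfl : n = m := by simpa using e
    intro z hz
    exact ⟨z, by simpa [iterMap_zero] using hz, rfl⟩
  | succ k ih =>
    intro z hz
    obtain ⟨y, hy, rfl⟩ := ih (n + 1) (by rw [← e]; push_cast; ring) (T n x) hz
    have hy' : dist (T n x) y < ρ ^ k * δ := by rw [dist_comm]; exact hy
    have h1 : ρ ^ k * δ ≤ δ :=
      mul_le_of_le_one_left hδ.le (pow_le_one₀ hρ.le hA.rho_lt_one.le)
    obtain ⟨w, rfl, hw⟩ := hA.exists_lift (hy'.trans_le h1)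
    refine ⟨w, ?_, rfl⟩
    rw [Metric.mem_ball, dist_comm]
    calc dist x w ≤ ρ * dist (T n x) (T n w) := hw
      _ < ρ * (ρ ^ k * δ) := by gcongr
      _ = ρ ^ (k + 1) * δ := by ring

include hA in
/-- Exactness holds at every scale, after a longer time. -/
theorem UniformlyExpanding.exists_exact_time {s : ℝ} (hs : 0 < s) :
    ∃ N : ℕ, ∀ (n m : ℤ) (e : n + (N : ℤ) = m) (x : X n),
      iterMap T N n m e '' Metric.ball x s = Set.univ := by
  obtain ⟨k, hk⟩ := exists_pow_lt_of_lt_one (div_pos hs hA.delta_pos) hA.rho_lt_one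
  have hk : ρ ^ k * δ < s := (lt_div_iff₀ hA.delta_pos).1 hk
  -- After `k` steps a ball of radius `s` has grown to contain a ball of radius `δ`, which covers
  -- everything `τ` steps later.
  refine ⟨k + τ, fun n m e x => Set.eq_univ_of_forall fun z => ?_⟩
  have e₂ : n + (k : ℤ) + (τ : ℤ) = m := by rw [← e]; push_cast; ring
  have hz : z ∈ iterMap T τ (n + k) m e₂ '' Metric.ball (iterMap T k n (n + k) rfl x) δ := by
    rw [hA.image_iterMap_ball]; trivial
  obtain ⟨w, hw, rfl⟩ := hz
  obtain ⟨y, hy, rfl⟩ := hA.ball_subset_image_iterMap k n _ rfl x hw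
  exact ⟨y, Metric.ball_subset_ball hk.le hy,
    iterMap_add k τ (k + τ) rfl n (n + k) m rfl e₂ e y⟩

/-! ### Two-sided bounds and bounded distortion for iterated operators. -/

section Bounds

variable [∀ n, CompactSpace (X n)]

theorem PositiveLinearMap.apply_nonneg {Y Z : Type*} [TopologicalSpace Y] [TopologicalSpace Z]
    (L : C(Y, ℝ) →ₚ[ℝ] C(Z, ℝ)) {f : C(Y, ℝ)} (hf : 0 ≤ f) (z : Z) : 0 ≤ L f z :=
  map_nonneg L hf z

theorem iInf_le_potential (φ : ∀ n, C(X n, ℝ)) (n : ℤ) (x : X n) : (⨅ y, φ n y) ≤ φ n x :=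
  ciInf_le (isCompact_range (φ n).continuous).bddBelow x

include hA in
theorem UniformlyExpanding.potential_le (n : ℤ) (x : X n) : φ n x ≤ (⨅ y, φ n y) + V := by
  have h1 := le_ciSup (isCompact_range (φ n).continuous).bddAbove x
  have h2 := hA.osc_le n
  linarith

theorem exp_mul_le_rpf {n : ℤ} {f : C(X n, ℝ)} (hf : 0 ≤ f) (y : X n) :
    Real.exp (⨅ z, φ n z) * f y ≤ rpf hA n f (T n y) := by
  rw [rpf_apply]
  calc Real.exp (⨅ z, φ n z) * f y ≤ Real.exp (φ n y) * f y :=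
        mul_le_mul_of_nonneg_right (Real.exp_le_exp.2 (iInf_le_potential φ n y)) (hf y)
    _ ≤ _ := Finset.single_le_sum (f := fun y => Real.exp (φ n y) * f y)
        (fun z _ => mul_nonneg (Real.exp_pos _).le (hf z)) (by simp)

theorem rpf_le {n : ℤ} {f : C(X n, ℝ)} {M : ℝ} (hM : 0 ≤ M) (hf : ∀ y, f y ≤ M)
    (x : X (n + 1)) :
    rpf hA n f x ≤ Real.exp (⨅ z, φ n z) * (D * Real.exp V) * M := by
  rw [rpf_apply]
  calc _ ≤ ∑ y ∈ (hA.finite_preimage n x).toFinset, Real.exp ((⨅ z, φ n z) + V) * M := by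
        refine Finset.sum_le_sum fun y _ => ?_
        exact (mul_le_mul_of_nonneg_left (hf y) (Real.exp_pos _).le).trans
          (mul_le_mul_of_nonneg_right (Real.exp_le_exp.2 (hA.potential_le n y)) hM)
    _ = (hA.finite_preimage n x).toFinset.card * (Real.exp ((⨅ z, φ n z) + V) * M) := by
        rw [Finset.sum_const, nsmul_eq_mul]
    _ ≤ D * (Real.exp ((⨅ z, φ n z) + V) * M) := by
        gcongr
        exact hA.card_preimage_le n x
    _ = _ := by rw [Real.exp_add]; ring

/-- The weight is the product of the factors `exp (inf φ)` along the way. The lower bound keeps one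
preimage and the upper bound counts at most `D` preimages per step; sharing the same weight, they
can be compared without any bound on the size of the potentials themselves. -/
theorem exists_weight (k : ℕ) (n m : ℤ) (e : n + (k : ℤ) = m) :
    ∃ w : ℝ, 0 < w ∧ ∀ f : C(X n, ℝ), 0 ≤ f →
      (∀ y, w * f y ≤ iterRpf hA k n m e f (iterMap T k n m e y)) ∧
      ∀ M : ℝ, 0 ≤ M → (∀ y, f y ≤ M) →
        ∀ x, iterRpf hA k n m e f x ≤ w * (D * Real.exp V) ^ k * M := by
  induction k generalizing n with
  | zero =>
    obtain rfl : n = m := by simpa using e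
    refine ⟨1, one_pos, fun f _ => ⟨fun y => ?_, fun M _ h x => ?_⟩⟩
    · simp [iterRpf_zero, iterMap_zero]
    · simpa [iterRpf_zero] using h x
  | succ k ih =>
    have e' : n + 1 + (k : ℤ) = m := by rw [← e]; push_cast; ring
    obtain ⟨w, hw, h⟩ := ih (n + 1) e'
    refine ⟨w * Real.exp (⨅ z, φ n z), mul_pos hw (Real.exp_pos _), fun f hf => ?_⟩
    obtain ⟨h1, h2⟩ := h (rpf hA n f) (map_nonneg _ hf)
    refine ⟨fun y => ?_, fun M hM hfM x => ?_⟩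
    · refine le_trans ?_ (h1 (T n y))
      rw [mul_assoc]
      exact mul_le_mul_of_nonneg_left (exp_mul_le_rpf hA hf y) hw.le
    · refine (h2 _ ?_ (rpf_le hA hM hfM) x).trans_eq ?_
      · positivity
      · ring

theorem iterRpf_one_pos [∀ n, Nonempty (X n)] (k : ℕ) (n m : ℤ) (e : n + (k : ℤ) = m) (x : X m) :
    0 < iterRpf hA k n m e 1 x := by
  obtain ⟨w, hw, h⟩ := exists_weight hA k n m e
  obtain ⟨y, rfl⟩ := hA.iterMap_surjective k n m e x
  have := (h 1 zero_le_one).1 y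
  simp only [ContinuousMap.one_apply, mul_one] at this
  exact hw.trans_le this

/-- A positive function that is controlled on a ball with full image at time `k` has an image of
bounded distortion. -/
theorem iterRpf_le_mul_of_exact [∀ n, Nonempty (X n)] {k : ℕ} {n m : ℤ} (e : n + (k : ℤ) = m)
    {s c : ℝ} (hex : ∀ x : X n, iterMap T k n m e '' Metric.ball x s = Set.univ)
    {f : C(X n, ℝ)} (hf : 0 ≤ f) (hc : 0 ≤ c)
    (hfc : ∀ z y : X n, y ∈ Metric.ball z s → f z ≤ c * f y)
    (x x' : X m) :
    iterRpf hA k n m e f x ≤ (D * Real.exp V) ^ k * c * iterRpf hA k n m e f x' := by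
  obtain ⟨w, hw, h⟩ := exists_weight hA k n m e
  -- Near a maximum point `z` there is a preimage `y` of `x'`, and `f y` is at least `f z / c`.
  obtain ⟨z, -, hz⟩ := isCompact_univ.exists_isMaxOn Set.univ_nonempty f.continuous.continuousOn
  have hz : ∀ y, f y ≤ f z := fun y => hz (Set.mem_univ y)
  obtain ⟨y, hy, hyx⟩ : x' ∈ iterMap T k n m e '' Metric.ball z s := by rw [hex]; trivial
  have h1 := (h f hf).1 y
  rw [hyx] at h1
  calc iterRpf hA k n m e f x ≤ w * (D * Real.exp V) ^ k * f z := (h f hf).2 _ (hf z) hz x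
    _ ≤ w * (D * Real.exp V) ^ k * (c * f y) := by
        gcongr
        exact hfc z y hy
    _ = (D * Real.exp V) ^ k * c * (w * f y) := by ring
    _ ≤ _ := by gcongr

theorem iterRpf_pos_of_exact [∀ n, Nonempty (X n)] {k : ℕ} {n m : ℤ} (e : n + (k : ℤ) = m)
    {s c : ℝ} (hex : ∀ x : X n, iterMap T k n m e '' Metric.ball x s = Set.univ)
    {f : C(X n, ℝ)} (hf : 0 ≤ f) (hf0 : f ≠ 0) (hc : 0 < c)
    (hfc : ∀ z y : X n, y ∈ Metric.ball z s → f z ≤ c * f y) (x : X m) :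
    0 < iterRpf hA k n m e f x := by
  obtain ⟨w, hw, h⟩ := exists_weight hA k n m e
  obtain ⟨z, hz⟩ : ∃ z, f z ≠ 0 := by
    by_contra! hh
    exact hf0 (ContinuousMap.ext hh)
  have hz : 0 < f z := lt_of_le_of_ne (hf z) (Ne.symm hz)
  obtain ⟨y, hy, rfl⟩ : x ∈ iterMap T k n m e '' Metric.ball z s := by rw [hex]; trivial
  have h2 : 0 < f y := pos_of_mul_pos_right (hz.trans_le (hfc z y hy)) hc.le
  exact (mul_pos hw h2).trans_le ((h f hf).1 y)

end Bounds

end Iterates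

/-! ### Cones of functions with controlled logarithmic oscillation. -/

section Cones

variable {X : ℤ → Type*} [∀ n, MetricSpace (X n)]

/-- The closed convex cone of nonnegative functions `f` with `f x ≤ exp (Q d(x, x')^α) f x'`
for points at distance less than `r`. -/
def localCone (X : ℤ → Type*) [∀ n, MetricSpace (X n)] (r α Q : ℝ) (n : ℤ) : Set C(X n, ℝ) :=
  {f | 0 ≤ f ∧ ∀ x x' : X n, dist x x' < r → f x ≤ Real.exp (Q * dist x x' ^ α) * f x'}

variable {r α Q : ℝ} {n : ℤ} {f g : C(X n, ℝ)}

theorem localCone_smul_mem (hf : f ∈ localCone X r α Q n) {c : ℝ} (hc : 0 ≤ c) :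
    c • f ∈ localCone X r α Q n := by
  refine ⟨smul_nonneg hc hf.1, fun x x' h => ?_⟩
  have := mul_le_mul_of_nonneg_left (hf.2 x x' h) hc
  simp only [ContinuousMap.smul_apply, smul_eq_mul]
  linarith

theorem localCone_mono {Q' : ℝ} (hQ : Q ≤ Q') (hf : f ∈ localCone X r α Q n) :
    f ∈ localCone X r α Q' n := by
  refine ⟨hf.1, fun x x' h => (hf.2 x x' h).trans ?_⟩
  exact mul_le_mul_of_nonneg_right (Real.exp_le_exp.2
    (mul_le_mul_of_nonneg_right hQ (Real.rpow_nonneg dist_nonneg _))) (hf.1 x')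

theorem one_mem_localCone (hQ : 0 ≤ Q) : (1 : C(X n, ℝ)) ∈ localCone X r α Q n := by
  refine ⟨zero_le_one, fun x x' _ => ?_⟩
  simpa using mul_nonneg hQ (Real.rpow_nonneg dist_nonneg _)

theorem localCone_le_mul (hα : 0 < α) (hQ : 0 ≤ Q) (hf : f ∈ localCone X r α Q n) {x x' : X n}
    (h : dist x x' < r) : f x ≤ Real.exp (Q * r ^ α) * f x' := by
  refine (hf.2 x x' h).trans (mul_le_mul_of_nonneg_right (Real.exp_le_exp.2 ?_) (hf.1 x'))
  exact mul_le_mul_of_nonneg_left (Real.rpow_le_rpow dist_nonneg h.le hα.le) hQ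

theorem localCone_of_tendsto {u : ℕ → C(X n, ℝ)} (hu : ∀ᶠ k in atTop, u k ∈ localCone X r α Q n)
    (hf : ∀ x, Tendsto (fun k => u k x) atTop (𝓝 (f x))) : f ∈ localCone X r α Q n :=
  ⟨fun x => ge_of_tendsto (hf x) (hu.mono fun _ h => h.1 x), fun x x' h =>
    le_of_tendsto_of_tendsto (hf x) ((hf x').const_mul _) (hu.mono fun _ hk => hk.2 x x' h)⟩

/-- In a cone with a smaller constant, a function bounded below dominates a small multiple of a
function bounded above, for the order of the larger cone. -/
theorem sub_smul_mem_localCone {θ μ M t : ℝ} (hr : 0 < r) (hα : 0 < α) (hQ : 0 < Q)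
    (hθ : 0 < θ) (hθ1 : θ < 1)
    (hf : f ∈ localCone X r α (θ * Q) n) (hg : g ∈ localCone X r α (θ * Q) n) (hμ : 0 ≤ μ)
    (hfμ : ∀ x, μ ≤ f x) (hgM : ∀ x, g x ≤ M) (ht : 0 ≤ t)
    (htM : t * M ≤ Real.exp (-(Q * r ^ α)) * ((1 - θ) / 2) * μ) :
    f - t • g ∈ localCone X r α Q n := by
  have hS : 0 ≤ Q * r ^ α := mul_nonneg hQ.le (Real.rpow_nonneg hr.le _)
  refine ⟨fun x => ?_, fun x x' h => ?_⟩
  · have h1 : Real.exp (-(Q * r ^ α)) * ((1 - θ) / 2) ≤ 1 :=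
      mul_le_one₀ (Real.exp_le_one_iff.2 (by linarith)) (by linarith) (by linarith)
    have h2 := mul_le_mul_of_nonneg_right h1 hμ
    have h3 := mul_le_mul_of_nonneg_left (hgM x) ht
    have h4 := hfμ x
    change 0 ≤ f x - t * g x
    linarith
  · set s := Q * dist x x' ^ α with hs
    have hs0 : 0 ≤ s := mul_nonneg hQ.le (Real.rpow_nonneg dist_nonneg _)
    have hsS : s ≤ Q * r ^ α :=
      mul_le_mul_of_nonneg_left (Real.rpow_le_rpow dist_nonneg h.le hα.le) hQ.le
    -- With `P = exp s` and `p = exp (θ * s)`, the claim is `t * (P * g x' - g x) ≤ P * f x' - f x`.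
    -- The right side is at least `(1 - θ) * s * μ` and the left at most `t * M * P * 2 * s`: both
    -- are linear in `s`, so the bound on `t * M` suffices however close the points are.
    have hF := hf.2 x x' h
    have hG := hg.2 x' x (by rwa [dist_comm])
    rw [dist_comm x' x] at hG
    rw [mul_assoc, ← hs] at hF hG
    set P := Real.exp s with hP
    set p := Real.exp (θ * s) with hp
    have hp1 : 1 ≤ p := Real.one_le_exp (by positivity)
    have hP0 : 0 < P := Real.exp_pos _
    have hPp : (1 - θ) * s ≤ P - p := by
      have : P = p * Real.exp ((1 - θ) * s) := by rw [hP, hp, ← Real.exp_add]; ring_nf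
      have h2 := Real.add_one_le_exp ((1 - θ) * s)
      have h3 : 0 ≤ (1 - θ) * s := mul_nonneg (by linarith) hs0
      nlinarith
    have hPq : P - p⁻¹ ≤ P * (2 * s) := by
      have h1 : Real.exp (-s) ≤ p⁻¹ := by
        rw [hp, ← Real.exp_neg]
        exact Real.exp_le_exp.2 (by nlinarith)
      have h2 : Real.exp (-s) = P * Real.exp (-(2 * s)) := by rw [hP, ← Real.exp_add]; ring_nf
      have h3 := Real.add_one_le_exp (-(2 * s))
      nlinarith
    have hPS : Real.exp (-(Q * r ^ α)) * P ≤ 1 := by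
      rw [hP, ← Real.exp_add]
      exact Real.exp_le_one_iff.2 (by linarith)
    have hGx : p⁻¹ * g x' ≤ g x := by
      rw [inv_mul_le_iff₀ (by positivity)]
      exact hG
    have hq : 0 ≤ P - p⁻¹ := by
      have : p⁻¹ ≤ 1 := inv_le_one_of_one_le₀ hp1
      have : 1 ≤ P := Real.one_le_exp hs0
      linarith
    have hM : g x' ≤ M := hgM x'
    have key : t * ((P - p⁻¹) * g x') ≤ (P - p) * f x' := by
      calc t * ((P - p⁻¹) * g x') ≤ t * ((P - p⁻¹) * M) := by gcongr
        _ = (t * M) * (P - p⁻¹) := by ring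
        _ ≤ (Real.exp (-(Q * r ^ α)) * ((1 - θ) / 2) * μ) * (P * (2 * s)) := by
            have : 0 ≤ Real.exp (-(Q * r ^ α)) * ((1 - θ) / 2) * μ :=
              mul_nonneg (mul_nonneg (Real.exp_pos _).le (by linarith)) hμ
            exact mul_le_mul htM hPq hq this
        _ = (Real.exp (-(Q * r ^ α)) * P) * ((1 - θ) * s * μ) := by ring
        _ ≤ 1 * ((1 - θ) * s * μ) :=
            mul_le_mul_of_nonneg_right hPS
              (mul_nonneg (mul_nonneg (by linarith) hs0) hμ)
        _ ≤ (P - p) * μ := by rw [one_mul]; exact mul_le_mul_of_nonneg_right hPp hμ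
        _ ≤ (P - p) * f x' :=
            mul_le_mul_of_nonneg_left (hfμ x')
              ((mul_nonneg (by linarith) hs0).trans hPp)
    have h5 := mul_le_mul_of_nonneg_left hGx ht
    simp only [ContinuousMap.sub_apply, ContinuousMap.smul_apply, smul_eq_mul]
    linarith

end Cones

/-! ### The transfer operators map cones into smaller cones. -/

section Contraction

variable {X : ℤ → Type*} [∀ n, MetricSpace (X n)] {T : ∀ n, X n → X (n + 1)}
  {φ : ∀ n, C(X n, ℝ)} {D : ℕ} {δ ρ : ℝ} {τ : ℕ} {H β V : ℝ}
  (hA : UniformlyExpanding T φ D δ ρ τ H β V)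

include hA in
/-- Lifts at distance less than `δ / 2` through the same inverse branch are unique. -/
theorem UniformlyExpanding.eq_of_dist_lift {n : ℤ} {a b c : X n} {R : ℝ} (h : T n a = T n b)
    (hR : R < δ / 2) (hR0 : 0 ≤ R) (ha : dist a c ≤ ρ * R) (hb : dist b c ≤ ρ * R) : a = b := by
  have h1 : ρ * R ≤ R := mul_le_of_le_one_left hR0 hA.rho_lt_one.le
  have h2 := dist_triangle_right a b c
  have h3 := hA.expanding n a b (by linarith)
  rw [h, dist_self, mul_zero] at h3
  exact dist_le_zero.1 h3

/-- Pair each preimage of `x` with a preimage of `x'` at distance at most `ρ * dist x x'`. The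
oscillations of `f` and of the potential add up to `Q + G`, and the contraction of distances
contributes `ρ ^ α`. Scale `δ / 2` makes the pairing injective. -/
theorem rpf_mem_localCone {α G Q : ℝ} {n : ℤ} (hα : 0 < α) (hG : 0 ≤ G) (hQ : 0 ≤ Q)
    (hφ : ∀ x x' : X n, dist x x' ≤ δ → |φ n x - φ n x'| ≤ G * dist x x' ^ α)
    {f : C(X n, ℝ)} (hf : f ∈ localCone X (δ / 2) α Q n) :
    rpf hA n f ∈ localCone X (δ / 2) α (ρ ^ α * (Q + G)) (n + 1) := by
  classical
  have hδ := hA.delta_pos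
  have hρ := hA.rho_pos
  refine ⟨map_nonneg _ hf.1, fun x x' hx => ?_⟩
  have hlift : ∀ y : X n, ∃ y', T n y = x → T n y' = x' ∧ dist y y' ≤ ρ * dist x x' := by
    intro y
    by_cases hy : T n y = x
    · obtain ⟨y', h1, h2⟩ := hA.exists_lift (y := y) (x' := x') (by rw [hy]; linarith)
      exact ⟨y', fun _ => ⟨h1, by rwa [hy] at h2⟩⟩
    · exact ⟨y, fun h => absurd h hy⟩
  choose ψ hψ using hlift
  rw [rpf_apply, rpf_apply, Finset.mul_sum]
  have hinj : Set.InjOn ψ (hA.finite_preimage n x).toFinset := by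
    intro a ha b hb hab
    have ha : T n a = x := by simpa using ha
    have hb : T n b = x := by simpa using hb
    refine hA.eq_of_dist_lift (c := ψ a) (ha.trans hb.symm) hx dist_nonneg (hψ a ha).2 ?_
    rw [hab]
    exact (hψ b hb).2
  have hterm : ∀ y ∈ (hA.finite_preimage n x).toFinset, Real.exp (φ n y) * f y ≤
      Real.exp (ρ ^ α * (Q + G) * dist x x' ^ α) * (Real.exp (φ n (ψ y)) * f (ψ y)) := by
    intro y hy
    have hy : T n y = x := by simpa using hy
    obtain ⟨h1, h2⟩ := hψ y hy
    have h3 : dist y (ψ y) < δ / 2 :=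
      h2.trans_lt ((mul_le_of_le_one_left dist_nonneg hA.rho_lt_one.le).trans_lt hx)
    have h4 : dist y (ψ y) ^ α ≤ ρ ^ α * dist x x' ^ α := by
      rw [← Real.mul_rpow hρ.le dist_nonneg]
      exact Real.rpow_le_rpow dist_nonneg h2 hα.le
    have h5 := (abs_le.1 (hφ y (ψ y) (by linarith))).2
    have h6 := mul_le_mul_of_nonneg_left h4 (add_nonneg hQ hG)
    calc Real.exp (φ n y) * f y
        ≤ Real.exp (φ n y) * (Real.exp (Q * dist y (ψ y) ^ α) * f (ψ y)) :=
          mul_le_mul_of_nonneg_left (hf.2 _ _ h3) (Real.exp_pos _).le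
      _ = Real.exp (φ n y + Q * dist y (ψ y) ^ α) * f (ψ y) := by rw [Real.exp_add]; ring
      _ ≤ Real.exp (ρ ^ α * (Q + G) * dist x x' ^ α + φ n (ψ y)) * f (ψ y) := by
          refine mul_le_mul_of_nonneg_right (Real.exp_le_exp.2 ?_) (hf.1 _)
          linarith
      _ = _ := by rw [Real.exp_add]; ring
  refine (Finset.sum_le_sum hterm).trans ?_
  -- By injectivity the paired terms form part of the sum over the preimages of `x'`; any remaining
  -- terms are nonnegative.
  rw [← Finset.sum_image (f := fun z =>
    Real.exp (ρ ^ α * (Q + G) * dist x x' ^ α) * (Real.exp (φ n z) * f z)) hinj]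
  refine Finset.sum_le_sum_of_subset_of_nonneg ?_ fun z _ _ =>
    mul_nonneg (Real.exp_pos _).le (mul_nonneg (Real.exp_pos _).le (hf.1 z))
  intro z hz
  obtain ⟨y, hy, rfl⟩ := Finset.mem_image.1 hz
  have hy : T n y = x := by simpa using hy
  simpa using (hψ y hy).1

/-- Constants for which the cones of exponent `α` and constant `Q` at scale `δ / 2` are contracted
by `N` steps of the transfer operators. -/
structure ContractionData (hA : UniformlyExpanding T φ D δ ρ τ H β V) (α G Q θ : ℝ) (N : ℕ) :
    Prop where
  exp_pos : 0 < α
  holder_nonneg : 0 ≤ G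
  holder : ∀ n (x x' : X n), dist x x' ≤ δ → |φ n x - φ n x'| ≤ G * dist x x' ^ α
  const_pos : 0 < Q
  factor_pos : 0 < θ
  factor_lt_one : θ < 1
  contracts : ρ ^ α * (Q + G) ≤ θ * Q
  time_pos : 0 < N
  exact : ∀ (n m : ℤ) (e : n + (N : ℤ) = m) (x : X n),
    iterMap T N n m e '' Metric.ball x (δ / 2) = Set.univ

/-- A bound for `f x / f x'` on the image of the cone after `N` steps. -/
noncomputable def distortion (D : ℕ) (δ V α Q : ℝ) (N : ℕ) : ℝ :=
  (D * Real.exp V) ^ N * Real.exp (Q * (δ / 2) ^ α)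

/-- The multiple appearing in `sub_smul_mem_localCone` at scale `δ / 2`. -/
noncomputable def domination (δ α Q θ : ℝ) : ℝ :=
  Real.exp (-(Q * (δ / 2) ^ α)) * ((1 - θ) / 2)

variable {hA} {α G Q θ : ℝ} {N : ℕ} (hc : ContractionData hA α G Q θ N)

include hc

theorem ContractionData.rpf_mem {n : ℤ} {f : C(X n, ℝ)} (hf : f ∈ localCone X (δ / 2) α Q n) :
    rpf hA n f ∈ localCone X (δ / 2) α (θ * Q) (n + 1) :=
  localCone_mono hc.contracts
    (rpf_mem_localCone hA hc.exp_pos hc.holder_nonneg hc.const_pos.le (hc.holder n) hf)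

theorem ContractionData.mem_of_mem {n : ℤ} {f : C(X n, ℝ)}
    (hf : f ∈ localCone X (δ / 2) α (θ * Q) n) : f ∈ localCone X (δ / 2) α Q n :=
  localCone_mono (mul_le_of_le_one_left hc.const_pos.le hc.factor_lt_one.le) hf

theorem ContractionData.iterRpf_mem (k : ℕ) (n m : ℤ) (e : n + (k : ℤ) = m) {f : C(X n, ℝ)}
    (hf : f ∈ localCone X (δ / 2) α Q n) :
    iterRpf hA k n m e f ∈ localCone X (δ / 2) α Q m := by
  induction k generalizing n with
  | zero =>
    obtain rfl : n = m := by simpa using e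
    exact hf
  | succ k ih =>
    exact ih (n + 1) (by rw [← e]; push_cast; ring) (hc.mem_of_mem (hc.rpf_mem hf))

theorem ContractionData.iterRpf_mem' {k : ℕ} (hk : 0 < k) {n m : ℤ} (e : n + (k : ℤ) = m)
    {f : C(X n, ℝ)} (hf : f ∈ localCone X (δ / 2) α Q n) :
    iterRpf hA k n m e f ∈ localCone X (δ / 2) α (θ * Q) m := by
  obtain ⟨j, rfl⟩ : ∃ j, k = j + 1 := ⟨k - 1, by omega⟩
  obtain ⟨l, rfl⟩ : ∃ l, m = l + 1 := ⟨m - 1, by ring⟩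
  have e' : n + (j : ℤ) = l := by push_cast at e; linarith
  rw [iterRpf_succ' hA j n l e e']
  exact hc.rpf_mem (hc.iterRpf_mem j n l e' hf)

variable [∀ n, CompactSpace (X n)] [∀ n, Nonempty (X n)]

/-- The distortion of the image of the cone after at least `N` steps. -/
theorem ContractionData.iterRpf_le_mul {k : ℕ} (hk : N ≤ k) {n m : ℤ} (e : n + (k : ℤ) = m)
    {f : C(X n, ℝ)} (hf : f ∈ localCone X (δ / 2) α Q n) (x x' : X m) :
    iterRpf hA k n m e f x ≤
      distortion D δ V α Q N * iterRpf hA k n m e f x' := by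
  obtain ⟨j, rfl⟩ := Nat.exists_eq_add_of_le' hk
  have e₂ : n + (j : ℤ) + (N : ℤ) = m := by rw [← e]; push_cast; ring
  rw [iterRpf_add hA j N (j + N) rfl n (n + j) m rfl e₂ e f]
  have hg := hc.iterRpf_mem j n (n + j) rfl hf
  refine iterRpf_le_mul_of_exact hA e₂ (hc.exact _ _ e₂) hg.1 (Real.exp_pos _).le ?_ x x'
  intro z y hy
  exact localCone_le_mul hc.exp_pos hc.const_pos.le hg (by rw [dist_comm]; exact hy)

theorem ContractionData.iterRpf_pos {k : ℕ} (hk : N ≤ k) {n m : ℤ} (e : n + (k : ℤ) = m)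
    {f : C(X n, ℝ)} (hf : f ∈ localCone X (δ / 2) α Q n) (hf0 : f ≠ 0) (x : X m) :
    0 < iterRpf hA k n m e f x := by
  refine iterRpf_pos_of_exact hA e
    (hA.image_iterMap_eq_univ hk hc.exact e) hf.1 hf0 (Real.exp_pos (Q * (δ / 2) ^ α)) ?_ x
  intro z y hy
  exact localCone_le_mul hc.exp_pos hc.const_pos.le hf (by rw [dist_comm]; exact hy)

end Contraction

/-! ### Exponential contraction in the order of the cone. -/

section Sandwich

variable {X : ℤ → Type*} [∀ n, MetricSpace (X n)] {T : ∀ n, X n → X (n + 1)}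
  {φ : ∀ n, C(X n, ℝ)} {D : ℕ} {δ ρ : ℝ} {τ : ℕ} {H β V : ℝ}
  {hA : UniformlyExpanding T φ D δ ρ τ H β V}

theorem apply_le_apply {Y Z : Type*} [TopologicalSpace Y] [TopologicalSpace Z]
    (L : C(Y, ℝ) →ₚ[ℝ] C(Z, ℝ)) {f g : C(Y, ℝ)} (h : ∀ y, f y ≤ g y) (z : Z) : L f z ≤ L g z :=
  (OrderHomClass.mono L (show f ≤ g from h)) z

include hA in
theorem UniformlyExpanding.one_le_growth [∀ n, Nonempty (X n)] : 1 ≤ D * Real.exp V :=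
  one_le_mul_of_one_le_of_one_le hA.one_le_card (Real.one_le_exp hA.osc_pos.le)

variable {α G Q θ : ℝ} {N : ℕ} (hc : ContractionData hA α G Q θ N)

include hc

theorem ContractionData.domination_pos : 0 < domination δ α Q θ := by
  have := hc.factor_lt_one
  exact mul_pos (Real.exp_pos _) (by linarith)

theorem ContractionData.domination_le_one : domination δ α Q θ ≤ 1 := by
  have h1 := hc.factor_lt_one
  have h2 := hc.factor_pos
  have h3 := hA.delta_pos
  refine mul_le_one₀ (Real.exp_le_one_iff.2 ?_) (by linarith) (by linarith)
  exact neg_nonpos.2 (mul_nonneg hc.const_pos.le (Real.rpow_nonneg (by linarith) _))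

variable [∀ n, Nonempty (X n)]

theorem ContractionData.one_le_distortion : 1 ≤ distortion D δ V α Q N := by
  have h3 := hA.delta_pos
  refine one_le_mul_of_one_le_of_one_le (one_le_pow₀ hA.one_le_growth) (Real.one_le_exp ?_)
  exact mul_nonneg hc.const_pos.le (Real.rpow_nonneg (by linarith) _)

theorem ContractionData.rate_mem :
    domination δ α Q θ / (2 * distortion D δ V α Q N ^ 2) ∈ Set.Ioo (0 : ℝ) 1 := by
  have hK := hc.one_le_distortion
  have hε := hc.domination_pos
  have hε1 := hc.domination_le_one
  have : 1 ≤ distortion D δ V α Q N ^ 2 := one_le_pow₀ hK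
  exact ⟨by positivity, (div_lt_one (by positivity)).2 (by linarith)⟩

variable [∀ n, CompactSpace (X n)]

/-- Bounded distortion turns the comparison of the two images at the single point `x₀` into a lower
bound for one and an upper bound for the other; each costs a factor of the distortion, hence its
square. -/
theorem ContractionData.sub_smul_mem {n m : ℤ} (e : n + (N : ℤ) = m) {f g : C(X n, ℝ)}
    (hf : f ∈ localCone X (δ / 2) α Q n) (hg : g ∈ localCone X (δ / 2) α Q n) {t : ℝ}
    (ht : 0 ≤ t) (x₀ : X m)
    (h : t * (distortion D δ V α Q N ^ 2 * iterRpf hA N n m e g x₀) ≤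
      domination δ α Q θ * iterRpf hA N n m e f x₀) :
    iterRpf hA N n m e f - t • iterRpf hA N n m e g ∈ localCone X (δ / 2) α Q m := by
  set K := distortion D δ V α Q N
  have hK : 0 < K := one_pos.trans_le hc.one_le_distortion
  refine sub_smul_mem_localCone (μ := iterRpf hA N n m e f x₀ / K)
    (M := K * iterRpf hA N n m e g x₀) (half_pos hA.delta_pos) hc.exp_pos
    hc.const_pos hc.factor_pos hc.factor_lt_one (hc.iterRpf_mem' hc.time_pos e hf)
    (hc.iterRpf_mem' hc.time_pos e hg) ?_ (fun x => ?_)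
    (fun x => hc.iterRpf_le_mul le_rfl e hg x x₀) ht ?_
  · exact div_nonneg ((hc.iterRpf_mem N n m e hf).1 x₀) hK.le
  · exact (div_le_iff₀' hK).2 (hc.iterRpf_le_mul le_rfl e hf x₀ x)
  · change _ ≤ domination δ α Q θ * _
    rw [← mul_div_assoc, le_div_iff₀ hK]
    linarith

/-- Since `f - a • g` and `b • g - f` add up to `(b - a) • g`, one of their images carries at least
half of the image of the sum at `x₀`. That one dominates `t` times the image of `g`, so its endpoint
moves by `t`. The conclusion is again membership in the cone, not a pointwise inequality, so that
the step can be iterated. -/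
theorem ContractionData.exists_contraction_step {n m : ℤ} (e : n + (N : ℤ) = m)
    {f g : C(X n, ℝ)} (hg : g ∈ localCone X (δ / 2) α Q n) {a b : ℝ} (hab : a ≤ b)
    (ha : f - a • g ∈ localCone X (δ / 2) α Q n) (hb : b • g - f ∈ localCone X (δ / 2) α Q n) :
    ∃ a' b' : ℝ, b' - a' = (1 - domination δ α Q θ / (2 * distortion D δ V α Q N ^ 2)) * (b - a) ∧
      a ≤ a' ∧ iterRpf hA N n m e f - a' • iterRpf hA N n m e g ∈ localCone X (δ / 2) α Q m ∧
      b' • iterRpf hA N n m e g - iterRpf hA N n m e f ∈ localCone X (δ / 2) α Q m := by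
  have hK : 0 < distortion D δ V α Q N := one_pos.trans_le hc.one_le_distortion
  have hε := hc.domination_pos
  set K := distortion D δ V α Q N
  set ε := domination δ α Q θ
  set t := ε / (2 * K ^ 2) * (b - a) with ht
  have ht0 : 0 ≤ t := mul_nonneg (by positivity) (by linarith)
  obtain ⟨x₀⟩ : Nonempty (X m) := inferInstance
  set F := iterRpf hA N n m e f with hF
  set Gm := iterRpf hA N n m e g with hGm
  have hU : iterRpf hA N n m e (f - a • g) = F - a • Gm := by rw [map_sub, map_smul]
  have hW : iterRpf hA N n m e (b • g - f) = b • Gm - F := by rw [map_sub, map_smul]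
  have hUm := hc.iterRpf_mem N n m e ha
  have hWm := hc.iterRpf_mem N n m e hb
  have hkey : ∀ U : ℝ, (b - a) * Gm x₀ ≤ 2 * U → t * (K ^ 2 * Gm x₀) ≤ ε * U := by
    intro U h
    have : t * (K ^ 2 * Gm x₀) = ε * ((b - a) * Gm x₀ / 2) := by
      rw [ht]; field_simp
    rw [this]
    exact mul_le_mul_of_nonneg_left (by linarith) hε.le
  have hval : (F - a • Gm) x₀ = F x₀ - a * Gm x₀ ∧ (b • Gm - F) x₀ = b * Gm x₀ - F x₀ :=
    ⟨rfl, rfl⟩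
  by_cases hcase : (b - a) * Gm x₀ ≤ 2 * (F - a • Gm) x₀
  · refine ⟨a + t, b, by rw [ht]; ring, by linarith, ?_, by rwa [hW] at hWm⟩
    have := hc.sub_smul_mem e ha hg ht0 x₀ (by rw [hU]; exact hkey _ hcase)
    rwa [hU, sub_sub, ← add_smul] at this
  · have hcase' : (b - a) * Gm x₀ ≤ 2 * (b • Gm - F) x₀ := by
      rw [hval.1] at hcase
      rw [hval.2]
      linarith
    refine ⟨a, b - t, by rw [ht]; ring, le_rfl, by rwa [hU] at hUm, ?_⟩
    have := hc.sub_smul_mem e hb hg ht0 x₀ (by rw [hW]; exact hkey _ hcase')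
    rwa [hW, sub_right_comm, ← sub_smul] at this

theorem ContractionData.exists_contraction (j : ℕ) (n m : ℤ) (e : n + ((N * j : ℕ) : ℤ) = m)
    {f g : C(X n, ℝ)} (hg : g ∈ localCone X (δ / 2) α Q n) {a b : ℝ} (hab : a ≤ b)
    (ha : f - a • g ∈ localCone X (δ / 2) α Q n) (hb : b • g - f ∈ localCone X (δ / 2) α Q n) :
    ∃ a' b' : ℝ,
      b' - a' = (1 - domination δ α Q θ / (2 * distortion D δ V α Q N ^ 2)) ^ j * (b - a) ∧
      a ≤ a' ∧
      iterRpf hA (N * j) n m e f - a' • iterRpf hA (N * j) n m e g ∈ localCone X (δ / 2) α Q m ∧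
      b' • iterRpf hA (N * j) n m e g - iterRpf hA (N * j) n m e f ∈
        localCone X (δ / 2) α Q m := by
  induction j generalizing n f g a b with
  | zero =>
    obtain rfl : n = m := by simpa using e
    exact ⟨a, b, by ring, le_rfl, ha, hb⟩
  | succ j ih =>
    obtain ⟨a₁, b₁, h1, h2, h3, h4⟩ := hc.exists_contraction_step (m := n + N) rfl hg hab ha hb
    have hab₁ : a₁ ≤ b₁ := by
      have := mul_nonneg (sub_nonneg.2 hc.rate_mem.2.le) (sub_nonneg.2 hab)
      linarith
    have e' : n + (N : ℤ) + ((N * j : ℕ) : ℤ) = m := by rw [← e]; push_cast; ring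
    obtain ⟨a₂, b₂, h5, h6, h7, h8⟩ :=
      ih (n + N) e' (hc.iterRpf_mem N n (n + N) rfl hg) hab₁ h3 h4
    rw [← iterRpf_add hA N (N * j) (N * (j + 1)) (by ring) n (n + N) m rfl e' e,
      ← iterRpf_add hA N (N * j) (N * (j + 1)) (by ring) n (n + N) m rfl e' e] at h7 h8
    exact ⟨a₂, b₂, by rw [h5, h1]; ring, h2.trans h6, h7, h8⟩

/-- Exponential contraction: two elements of the cone become proportional at a uniform
exponential speed. -/
theorem ContractionData.exists_sandwich :
    ∃ C γ : ℝ, 0 < C ∧ 0 < γ ∧ γ < 1 ∧ ∀ (k : ℕ) (n m : ℤ) (e : n + (k : ℤ) = m), N ≤ k →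
      ∀ f ∈ localCone X (δ / 2) α Q n, ∀ g ∈ localCone X (δ / 2) α Q n, ∀ B : ℝ, 0 < B →
      (∃ x₀, iterRpf hA N n (n + N) rfl f x₀ ≤ B * iterRpf hA N n (n + N) rfl g x₀) →
      ∃ a : ℝ, 0 ≤ a ∧ ∀ x, a * iterRpf hA k n m e g x ≤ iterRpf hA k n m e f x ∧
        iterRpf hA k n m e f x ≤ (a + C * B * γ ^ k) * iterRpf hA k n m e g x := by
  have hK : 0 < distortion D δ V α Q N := one_pos.trans_le hc.one_le_distortion
  have hε := hc.domination_pos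
  obtain ⟨hη, hη1⟩ := hc.rate_mem
  set K := distortion D δ V α Q N
  set ε := domination δ α Q θ with hεdef
  set q := 1 - ε / (2 * K ^ 2) with hq
  have hq0 : 0 < q := by linarith
  have hq1 : q < 1 := by linarith
  -- The gap shrinks by `q` every `N` steps, that is by `γ` per step.
  set γ := q ^ ((N : ℝ)⁻¹) with hγ
  have hγ0 : 0 < γ := Real.rpow_pos_of_pos hq0 _
  have hγ1 : γ < 1 := Real.rpow_lt_one hq0.le hq1
    (inv_pos.2 (Nat.cast_pos.2 hc.time_pos))
  have hγN : γ ^ N = q := Real.rpow_inv_natCast_pow hq0.le hc.time_pos.ne'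
  refine ⟨K ^ 2 / ε / q ^ 2, γ, by positivity, hγ0, hγ1, ?_⟩
  rintro k n m e hk f hf g hg B hB ⟨x₀, hx₀⟩
  -- The first `N` steps create the initial sandwich, `j` blocks contract it, and the last `i` steps
  -- only use positivity. As `k ≤ N * (j + 2)`, the two blocks without contraction cost the factor
  -- `q ^ 2` in the constant.
  obtain ⟨j, i, hi, hkj⟩ : ∃ j i, i < N ∧ k = N + N * j + i := by
    refine ⟨(k - N) / N, (k - N) % N, Nat.mod_lt _ hc.time_pos, ?_⟩
    have := Nat.div_add_mod (k - N) N
    omega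
  have e₁ : n + (N : ℤ) + ((N * j : ℕ) : ℤ) = n + ((N + N * j : ℕ) : ℤ) := by push_cast; ring
  have e₂ : n + ((N + N * j : ℕ) : ℤ) + (i : ℤ) = m := by rw [← e, hkj]; push_cast; ring
  have hsplit : ∀ u, iterRpf hA k n m e u = iterRpf hA i _ m e₂
      (iterRpf hA (N * j) _ _ e₁ (iterRpf hA N n (n + N) rfl u)) := by
    intro u
    rw [iterRpf_add hA (N + N * j) i k hkj n _ m rfl e₂ e,
      iterRpf_add hA N (N * j) (N + N * j) rfl n (n + N) _ rfl e₁ rfl]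
  have hF := hc.iterRpf_mem N n _ rfl hf
  have hGm := hc.iterRpf_mem N n _ rfl hg
  set b := K ^ 2 * B / ε with hb
  have hb0 : 0 < b := by positivity
  -- The comparison at `x₀` shows that the image of `g` dominates `b⁻¹` times that of `f` in the
  -- cone; the lower endpoint starts at zero.
  have hbm : b • iterRpf hA N n (n + N) rfl g - iterRpf hA N n (n + N) rfl f ∈
      localCone X (δ / 2) α Q (n + N) := by
    have h1 := hc.sub_smul_mem (t := b⁻¹) rfl hg hf (by positivity) x₀ (by
      rw [inv_mul_le_iff₀ hb0]
      calc K ^ 2 * iterRpf hA N n (n + N) rfl f x₀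
          ≤ K ^ 2 * (B * iterRpf hA N n (n + N) rfl g x₀) := by gcongr
        _ = _ := by rw [hb, ← hεdef]; field_simp)
    have h2 := localCone_smul_mem h1 hb0.le
    rwa [smul_sub, smul_smul, mul_inv_cancel₀ hb0.ne', one_smul] at h2
  obtain ⟨a', b', h1, h2, h3, h4⟩ := hc.exists_contraction j _ _ e₁ hGm (a := 0) hb0.le
    (by rwa [zero_smul, sub_zero]) hbm
  refine ⟨a', h2, fun x => ?_⟩
  have h5 := map_nonneg (iterRpf hA i _ m e₂) h3.1
  have h6 := map_nonneg (iterRpf hA i _ m e₂) h4.1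
  rw [map_sub, map_smul, ← hsplit, ← hsplit] at h5 h6
  have h5 : 0 ≤ iterRpf hA k n m e f x - a' * iterRpf hA k n m e g x := h5 x
  have h6 : 0 ≤ b' * iterRpf hA k n m e g x - iterRpf hA k n m e f x := h6 x
  refine ⟨by linarith, ?_⟩
  have hgx : 0 ≤ iterRpf hA k n m e g x := (hc.iterRpf_mem k n m e hg).1 x
  have hb' : b' ≤ a' + K ^ 2 / ε / q ^ 2 * B * γ ^ k := by
    have h7 : q ^ j * q ^ 2 ≤ γ ^ k := by
      rw [← hγN, ← pow_mul, ← pow_mul, ← pow_add]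
      exact pow_le_pow_of_le_one hγ0.le hγ1.le (by rw [hkj]; omega)
    have h8 : q ^ j ≤ γ ^ k / q ^ 2 := (le_div_iff₀ (by positivity)).2 h7
    have h9 : q ^ j * b ≤ γ ^ k / q ^ 2 * b := by gcongr
    have h10 : γ ^ k / q ^ 2 * b = K ^ 2 / ε / q ^ 2 * B * γ ^ k := by rw [hb]; field_simp
    linarith
  nlinarith

end Sandwich

/-! ### Integrals of continuous functions against finite measures. -/

section Pairing

variable {Y : Type*} [MetricSpace Y] [CompactSpace Y] [MeasurableSpace Y] [BorelSpace Y]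

theorem integrable_continuousMap (f : C(Y, ℝ)) (σ : FiniteMeasure Y) :
    Integrable f (σ : Measure Y) :=
  f.continuous.integrable_of_hasCompactSupport (HasCompactSupport.of_compactSpace f)

theorem pairing_sub (f g : C(Y, ℝ)) (σ : FiniteMeasure Y) :
    pairing (f - g) σ = pairing f σ - pairing g σ :=
  integral_sub (integrable_continuousMap f σ) (integrable_continuousMap g σ)

theorem pairing_add (f g : C(Y, ℝ)) (σ : FiniteMeasure Y) :
    pairing (f + g) σ = pairing f σ + pairing g σ :=
  integral_add (integrable_continuousMap f σ) (integrable_continuousMap g σ)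

theorem pairing_smul (c : ℝ) (f : C(Y, ℝ)) (σ : FiniteMeasure Y) :
    pairing (c • f) σ = c * pairing f σ :=
  integral_const_mul c _

theorem pairing_nnreal_smul (c : ℝ≥0) (f : C(Y, ℝ)) (σ : FiniteMeasure Y) :
    pairing f (c • σ) = c * pairing f σ := by
  unfold pairing
  rw [FiniteMeasure.toMeasure_smul, integral_smul_nnreal_measure]
  rfl

theorem pairing_one (σ : FiniteMeasure Y) : pairing 1 σ = σ.mass := by
  unfold pairing
  simp only [ContinuousMap.one_apply, integral_const, smul_eq_mul, mul_one]
  rfl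

theorem pairing_one_eq_one (σ : FiniteMeasure Y) [IsProbabilityMeasure (σ : Measure Y)] :
    pairing 1 σ = 1 := by
  simp [pairing]

theorem pairing_nonneg {f : C(Y, ℝ)} (hf : 0 ≤ f) (σ : FiniteMeasure Y) : 0 ≤ pairing f σ :=
  integral_nonneg hf

theorem pairing_mono {f g : C(Y, ℝ)} (h : ∀ y, f y ≤ g y) (σ : FiniteMeasure Y) :
    pairing f σ ≤ pairing g σ :=
  integral_mono (integrable_continuousMap f σ) (integrable_continuousMap g σ) h

theorem pairing_mul_le {f g : C(Y, ℝ)} {a : ℝ} (h : ∀ y, a * g y ≤ f y) (σ : FiniteMeasure Y) :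
    a * pairing g σ ≤ pairing f σ := by
  rw [← pairing_smul]
  exact pairing_mono h σ

theorem pairing_le_mul {f g : C(Y, ℝ)} {a : ℝ} (h : ∀ y, f y ≤ a * g y) (σ : FiniteMeasure Y) :
    pairing f σ ≤ a * pairing g σ := by
  rw [← pairing_smul]
  exact pairing_mono h σ

theorem mass_pos_of_ne_zero {σ : FiniteMeasure Y} (hσ : σ ≠ 0) : (0 : ℝ) < σ.mass :=
  NNReal.coe_pos.2 (pos_iff_ne_zero.2 ((FiniteMeasure.mass_nonzero_iff σ).2 hσ))

theorem pairing_pos [Nonempty Y] {f : C(Y, ℝ)} (hf : ∀ y, 0 < f y) {σ : FiniteMeasure Y}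
    (hσ : σ ≠ 0) : 0 < pairing f σ := by
  obtain ⟨z, -, hz⟩ := isCompact_univ.exists_isMinOn Set.univ_nonempty f.continuous.continuousOn
  have h := pairing_mul_le (f := f) (g := 1) (a := f z)
    (fun y => by simpa using hz (Set.mem_univ y)) σ
  rw [pairing_one] at h
  exact (mul_pos (hf z) (mass_pos_of_ne_zero hσ)).trans_le h

theorem abs_pairing_le (f : C(Y, ℝ)) (σ : FiniteMeasure Y) :
    |pairing f σ| ≤ ‖f‖ * pairing 1 σ := by
  refine abs_le.2 ⟨?_, pairing_le_mul (fun y => ?_) σ⟩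
  · rw [← neg_mul]
    refine pairing_mul_le (fun y => ?_) σ
    simpa using (abs_le.1 (f.norm_coe_le_norm y)).1
  · simpa using (abs_le.1 (f.norm_coe_le_norm y)).2

theorem ne_zero_of_isProbabilityMeasure {σ : FiniteMeasure Y}
    (h : IsProbabilityMeasure (σ : Measure Y)) : σ ≠ 0 := by
  rintro rfl
  have := pairing_one_eq_one (0 : FiniteMeasure Y)
  rw [pairing_one] at this
  simp at this

theorem pairing_inv_mass_smul (f : C(Y, ℝ)) (σ : FiniteMeasure Y) :
    pairing f (σ.mass⁻¹ • σ) = pairing f σ / pairing 1 σ := by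
  rw [pairing_nnreal_smul, pairing_one, NNReal.coe_inv, div_eq_inv_mul]

theorem isProbabilityMeasure_inv_mass_smul {σ : FiniteMeasure Y} (hσ : σ ≠ 0) :
    IsProbabilityMeasure ((σ.mass⁻¹ • σ : FiniteMeasure Y) : Measure Y) := by
  have : Nonempty Y := by
    by_contra h
    rw [not_nonempty_iff] at h
    exact hσ (FiniteMeasure.toMeasure_injective (Subsingleton.elim _ _))
  rw [← FiniteMeasure.normalize_eq_inv_mass_smul_of_nonzero σ hσ]
  exact inferInstanceAs (IsProbabilityMeasure (σ.normalize : Measure Y))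

theorem exists_le_of_pairing_le {f g : C(Y, ℝ)} {σ : FiniteMeasure Y}
    (hσ : IsProbabilityMeasure (σ : Measure Y)) (h : pairing f σ ≤ pairing g σ) :
    ∃ y, f y ≤ g y := by
  obtain ⟨y, hy⟩ := exists_integral_le (integrable_continuousMap (g - f) σ)
  have h1 : pairing (g - f) σ ≤ (g - f) y := hy
  rw [pairing_sub] at h1
  have h2 : (g - f) y = g y - f y := rfl
  exact ⟨y, by linarith⟩

theorem pairing_ratio_mem {f g : C(Y, ℝ)} {a b : ℝ} (hab : ∀ y, a * g y ≤ f y ∧ f y ≤ b * g y)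
    {σ : FiniteMeasure Y} (hg : 0 < pairing g σ) :
    a ≤ pairing f σ / pairing g σ ∧ pairing f σ / pairing g σ ≤ b :=
  ⟨(le_div_iff₀ hg).2 (pairing_mul_le (fun y => (hab y).1) σ),
    (div_le_iff₀ hg).2 (pairing_le_mul (fun y => (hab y).2) σ)⟩

end Pairing

/-! ### The cones test weak convergence. -/

section Convergence

variable {X : ℤ → Type*} [∀ n, MetricSpace (X n)] [∀ n, CompactSpace (X n)]

/-- A large additive constant makes the relative oscillation of a Lipschitz function small. The
condition `α ≤ 1` is what bounds `dist x x'` by a multiple of `dist x x' ^ α` at small distances. -/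
theorem lipschitz_add_const_mem_localCone {r α Q : ℝ} {n : ℤ} (hr : 0 < r) (hα1 : α ≤ 1)
    (hQ : 0 < Q) {f : C(X n, ℝ)} {K : ℝ≥0} (hf : LipschitzWith K f) :
    f + (‖f‖ + K * r ^ (1 - α) / Q) • (1 : C(X n, ℝ)) ∈ localCone X r α Q n := by
  have hrα : 0 ≤ r ^ (1 - α) := Real.rpow_nonneg hr.le _
  have hKr : 0 ≤ K * r ^ (1 - α) / Q := by positivity
  have hval : ∀ x, (f + (‖f‖ + K * r ^ (1 - α) / Q) • (1 : C(X n, ℝ))) x =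
      f x + (‖f‖ + K * r ^ (1 - α) / Q) := fun x => by simp
  have hnorm : ∀ x, -‖f‖ ≤ f x := fun x => (abs_le.1 (f.norm_coe_le_norm x)).1
  refine ⟨fun x => ?_, fun x x' h => ?_⟩
  · have := hnorm x
    refine le_of_le_of_eq ?_ (hval x).symm
    change 0 ≤ _
    linarith
  · rw [hval, hval]
    have h1 : f x - f x' ≤ K * dist x x' :=
      (le_abs_self _).trans (by simpa [Real.dist_eq] using hf.dist_le_mul x x')
    have h2 : dist x x' ≤ dist x x' ^ α * r ^ (1 - α) := by
      rcases (dist_nonneg (x := x) (y := x')).eq_or_lt with h0 | h0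
      · rw [← h0]
        exact mul_nonneg (Real.rpow_nonneg le_rfl _) hrα
      · calc dist x x' = dist x x' ^ α * dist x x' ^ (1 - α) := by
              rw [← Real.rpow_add h0]; simp
          _ ≤ _ := by
              gcongr
    have h3 := Real.add_one_le_exp (Q * dist x x' ^ α)
    have hd : 0 ≤ dist x x' ^ α := Real.rpow_nonneg dist_nonneg _
    have h4 := hnorm x'
    set W := f x' + (‖f‖ + K * r ^ (1 - α) / Q) with hW
    have h5 : K * r ^ (1 - α) / Q ≤ W := by linarith
    have h6 : (Q * dist x x' ^ α + 1) * W ≤ Real.exp (Q * dist x x' ^ α) * W :=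
      mul_le_mul_of_nonneg_right h3 (hKr.trans h5)
    have h7 : Q * dist x x' ^ α * (K * r ^ (1 - α) / Q) ≤ Q * dist x x' ^ α * W := by gcongr
    have h8 : Q * dist x x' ^ α * (K * r ^ (1 - α) / Q) = K * (dist x x' ^ α * r ^ (1 - α)) := by
      field_simp
    have h9 : K * dist x x' ≤ K * (dist x x' ^ α * r ^ (1 - α)) := by gcongr
    linarith

variable [∀ n, MeasurableSpace (X n)] [∀ n, BorelSpace (X n)]

/-- A cone with exponent at most one determines weak convergence of probability measures. -/
theorem tendsto_of_forall_mem_localCone {r α Q : ℝ} {n : ℤ} (hr : 0 < r) (hα1 : α ≤ 1)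
    (hQ : 0 < Q) {p : ℕ → FiniteMeasure (X n)} {μ : FiniteMeasure (X n)}
    (hp : ∀ k, IsProbabilityMeasure (p k : Measure (X n)))
    (hμ : IsProbabilityMeasure (μ : Measure (X n)))
    (h : ∀ f ∈ localCone X r α Q n, Tendsto (fun k => pairing f (p k)) atTop (𝓝 (pairing f μ))) :
    Tendsto p atTop (𝓝 μ) := by
  let p' : ℕ → ProbabilityMeasure (X n) := fun k => ⟨p k, hp k⟩
  let μ' : ProbabilityMeasure (X n) := ⟨μ, hμ⟩
  have key : Tendsto p' atTop (𝓝 μ') := by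
    rw [tendsto_iff_forall_lipschitz_integral_tendsto]
    rintro f - ⟨K, hK⟩
    let f' : C(X n, ℝ) := ⟨f, hK.continuous⟩
    have h1 := h _ (lipschitz_add_const_mem_localCone hr hα1 hQ (f := f') hK)
    simp only [pairing_add, pairing_smul, pairing_one_eq_one] at h1
    simpa [pairing, f', p', μ'] using h1.sub_const (‖f'‖ + K * r ^ (1 - α) / Q)
  exact (ProbabilityMeasure.tendsto_nhds_iff_toFiniteMeasure_tendsto_nhds _).1 key

end Convergence

/-! ### Existence and uniqueness of the eigenmeasures. -/

section Conformal

variable {X : ℤ → Type*} [∀ n, MetricSpace (X n)] [∀ n, CompactSpace (X n)]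
  [∀ n, Nonempty (X n)] [∀ n, MeasurableSpace (X n)] [∀ n, BorelSpace (X n)]
  {T : ∀ n, X n → X (n + 1)} {φ : ∀ n, C(X n, ℝ)} {D : ℕ} {δ ρ : ℝ} {τ : ℕ} {H β V : ℝ}
  (hA : UniformlyExpanding T φ D δ ρ τ H β V)

/-- Positivity of a measure on the functions that become nonnegative in the future. -/
def IsDualPositive (n : ℤ) (μ : FiniteMeasure (X n)) : Prop :=
  ∀ (k : ℕ) (m : ℤ) (e : n + (k : ℤ) = m) (u : C(X n, ℝ)),
    0 ≤ iterRpf hA k n m e u → 0 ≤ pairing u μ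

theorem dualMeasure_ne_zero {k : ℕ} {n m : ℤ} (e : n + (k : ℤ) = m) {σ : FiniteMeasure (X m)}
    (hσ : σ ≠ 0) : dualMeasure (iterRpf hA k n m e) σ ≠ 0 := by
  intro h0
  have h1 := pairing_pos (iterRpf_one_pos hA k n m e) hσ
  rw [← pairing_dualMeasure, h0, pairing_one] at h1
  simp at h1

/-- Positivity on the functions whose `k`-th iterate is nonnegative is a closed condition that gets
stronger with `k`, and the normalised pullback of a Dirac mass from time `n + k` satisfies it.
Compactness of the space of probability measures gives a common point. -/
theorem exists_isDualPositive (n : ℤ) :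
    ∃ μ : FiniteMeasure (X n), IsProbabilityMeasure (μ : Measure (X n)) ∧
      IsDualPositive hA n μ := by
  let S : ℕ → Set (ProbabilityMeasure (X n)) := fun k =>
    {μ | ∀ u, 0 ≤ iterRpf hA k n (n + k) rfl u → 0 ≤ pairing u μ.toFiniteMeasure}
  have hclosed : ∀ k, IsClosed (S k) := by
    intro k
    have : S k = ⋂ (u : C(X n, ℝ)) (_ : 0 ≤ iterRpf hA k n (n + k) rfl u),
        {μ : ProbabilityMeasure (X n) | 0 ≤ ∫ x, u x ∂(μ : Measure (X n))} := by
      ext μ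
      simp only [S, Set.mem_iInter]
      rfl
    rw [this]
    exact isClosed_iInter fun u => isClosed_iInter fun _ => isClosed_le continuous_const
      (ProbabilityMeasure.continuous_integral_continuousMap u)
  have hne : ∀ k, (S k).Nonempty := by
    intro k
    obtain ⟨x⟩ : Nonempty (X (n + k)) := inferInstance
    let σ : FiniteMeasure (X (n + k)) := ⟨Measure.dirac x, inferInstance⟩
    have hσ : σ ≠ 0 := ne_zero_of_isProbabilityMeasure
      (inferInstanceAs (IsProbabilityMeasure (Measure.dirac x)))
    have h0 := dualMeasure_ne_zero hA rfl hσ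
    refine ⟨⟨_, isProbabilityMeasure_inv_mass_smul h0⟩, fun u hu => ?_⟩
    have h1 := pairing_inv_mass_smul u (dualMeasure (iterRpf hA k n (n + k) rfl) σ)
    rw [pairing_dualMeasure, pairing_dualMeasure] at h1
    refine le_of_le_of_eq ?_ h1.symm
    exact div_nonneg (pairing_nonneg hu _)
      (pairing_nonneg (map_nonneg _ zero_le_one) _)
  have hanti : ∀ k, S (k + 1) ⊆ S k := by
    intro k μ hμ u hu
    refine hμ u ?_
    rw [iterRpf_add hA k 1 (k + 1) rfl n (n + k) (n + (k + 1 : ℕ)) rfl (by push_cast; ring)]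
    exact map_nonneg _ hu
  obtain ⟨μ, hμ⟩ := IsCompact.nonempty_iInter_of_sequence_nonempty_isCompact_isClosed S hanti hne
    (hclosed 0).isCompact hclosed
  refine ⟨μ.toFiniteMeasure, inferInstanceAs (IsProbabilityMeasure (μ : Measure (X n))), ?_⟩
  rintro k m rfl u hu
  exact Set.mem_iInter.1 hμ k u hu

variable {hA} in
theorem IsDualPositive.normalize_dualMeasure {n : ℤ} {μ : FiniteMeasure (X (n + 1))}
    (hμ : IsDualPositive hA (n + 1) μ) :
    IsDualPositive hA n ((dualMeasure (rpf hA n) μ).mass⁻¹ • dualMeasure (rpf hA n) μ) := by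
  rintro k m e u hu
  rw [pairing_inv_mass_smul, pairing_dualMeasure, pairing_dualMeasure]
  refine div_nonneg (hμ k (m + 1) (by rw [← e]; ring) _ ?_)
    (pairing_nonneg (map_nonneg _ zero_le_one) _)
  rw [← iterRpf_succ hA k n (m + 1) (by rw [← e]; push_cast; ring),
    iterRpf_succ' hA k n m _ e]
  exact map_nonneg _ hu

/-- Two normalised measures that are positive on eventually nonnegative functions coincide. -/
theorem IsDualPositive.eq {hA : UniformlyExpanding T φ D δ ρ τ H β V} {α G Q θ : ℝ} {N : ℕ}
    (hc : ContractionData hA α G Q θ N) (hα1 : α ≤ 1) {n : ℤ} {μ ν : FiniteMeasure (X n)}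
    (hμp : IsProbabilityMeasure (μ : Measure (X n)))
    (hνp : IsProbabilityMeasure (ν : Measure (X n)))
    (hμ : IsDualPositive hA n μ) (hν : IsDualPositive hA n ν) : μ = ν := by
  obtain ⟨C, γ, hC, hγ, hγ1, h⟩ := hc.exists_sandwich
  have key : ∀ f ∈ localCone X (δ / 2) α Q n, pairing f μ = pairing f ν := by
    intro f hf
    have hB : 0 < ‖f‖ + 1 := by positivity
    have hle : ∀ k : ℕ, |pairing f μ - pairing f ν| ≤ C * (‖f‖ + 1) * γ ^ (k + N) := by
      intro k
      obtain ⟨a, -, ha⟩ := h (k + N) n _ rfl (by omega) f hf 1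
        (one_mem_localCone hc.const_pos.le) (‖f‖ + 1) hB (by
          obtain ⟨x₀⟩ : Nonempty (X (n + N)) := inferInstance
          refine ⟨x₀, ?_⟩
          have := apply_le_apply (iterRpf hA N n (n + N) rfl) (f := f) (g := (‖f‖ + 1) • 1)
            (fun y => ?_) x₀
          · rwa [map_smul] at this
          · have := (abs_le.1 (f.norm_coe_le_norm y)).2
            simp only [ContinuousMap.smul_apply, ContinuousMap.one_apply, smul_eq_mul, mul_one]
            linarith)
      -- The sandwich says that `f - a • 1` and its upper counterpart become nonnegative, so every
      -- admissible probability measure gives `f` an integral in the same short interval.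
      have hint : ∀ σ : FiniteMeasure (X n), IsProbabilityMeasure (σ : Measure (X n)) →
          IsDualPositive hA n σ →
          a ≤ pairing f σ ∧ pairing f σ ≤ a + C * (‖f‖ + 1) * γ ^ (k + N) := by
        intro σ hσ hσp
        have h1 := hσp (k + N) _ rfl (f - a • 1) (fun x => by
          rw [map_sub, map_smul]
          exact sub_nonneg.2 (ha x).1)
        have h2 := hσp (k + N) _ rfl ((a + C * (‖f‖ + 1) * γ ^ (k + N)) • 1 - f) (fun x => by
          rw [map_sub, map_smul]
          exact sub_nonneg.2 (ha x).2)
        rw [pairing_sub, pairing_smul, pairing_one_eq_one] at h1 h2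
        exact ⟨by linarith, by linarith⟩
      obtain ⟨h1, h2⟩ := hint μ hμp hμ
      obtain ⟨h3, h4⟩ := hint ν hνp hν
      exact abs_le.2 ⟨by linarith, by linarith⟩
    have hlim : Tendsto (fun k : ℕ => C * (‖f‖ + 1) * γ ^ (k + N)) atTop (𝓝 0) := by
      have := ((tendsto_pow_atTop_nhds_zero_of_lt_one hγ.le hγ1).comp
        (tendsto_add_atTop_nat N)).const_mul (C * (‖f‖ + 1))
      simpa using this
    have := ge_of_tendsto' hlim hle
    exact sub_eq_zero.1 (abs_eq_zero.1 (le_antisymm this (abs_nonneg _)))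
  have hlim := tendsto_of_forall_mem_localCone (half_pos hA.delta_pos) hα1 hc.const_pos
    (p := fun _ => μ) (fun _ => hμp) hνp (fun f hf => by rw [key f hf]; exact tendsto_const_nhds)
  exact tendsto_nhds_unique tendsto_const_nhds hlim

/-- A family of probability measures with `L_n^* m_{n+1} = λ_n m_n`. -/
structure ConformalFamily (m : ∀ n, FiniteMeasure (X n)) (lam : ℤ → ℝ) : Prop where
  prob : ∀ n, IsProbabilityMeasure (m n : Measure (X n))
  lam_pos : ∀ n, 0 < lam n
  dual : ∀ n, dualMeasure (rpf hA n) (m (n + 1)) = (lam n).toNNReal • m n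

theorem rpf_one_pos (n : ℤ) (x : X (n + 1)) : 0 < rpf hA n 1 x :=
  iterRpf_one_pos hA 1 n (n + 1) (by simp) x

/-- The measures are chosen independently for each `n`; the normalised pullback of the next one has
the same positivity property, so uniqueness forces compatibility. -/
theorem exists_conformalFamily {hA : UniformlyExpanding T φ D δ ρ τ H β V} {α G Q θ : ℝ} {N : ℕ}
    (hc : ContractionData hA α G Q θ N) (hα1 : α ≤ 1) :
    ∃ m lam, ConformalFamily hA m lam := by
  choose m hm hpos using exists_isDualPositive hA
  refine ⟨m, fun n => pairing (rpf hA n 1) (m (n + 1)), hm, fun n =>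
    pairing_pos (rpf_one_pos hA n) (ne_zero_of_isProbabilityMeasure (hm _)), fun n => ?_⟩
  have hne := dualMeasure_ne_zero hA (k := 1) (n := n) (m := n + 1) (by simp)
    (ne_zero_of_isProbabilityMeasure (hm (n + 1)))
  change dualMeasure (rpf hA n) _ ≠ 0 at hne
  have h := IsDualPositive.eq hc hα1 (isProbabilityMeasure_inv_mass_smul hne) (hm n)
    (hpos (n + 1)).normalize_dualMeasure (hpos n)
  rw [← h, ← pairing_dualMeasure, pairing_one, Real.toNNReal_coe, smul_smul,
    mul_inv_cancel₀ ((FiniteMeasure.mass_nonzero_iff _).2 hne), one_smul]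

/-- Uniqueness of the conformal measures along a forward half-line. -/
theorem ConformalFamily.eq_of_forward {hA : UniformlyExpanding T φ D δ ρ τ H β V}
    {α G Q θ : ℝ} {N : ℕ}
    (hc : ContractionData hA α G Q θ N) (hα1 : α ≤ 1) {n₀ : ℤ} {μ ν : ∀ n, FiniteMeasure (X n)}
    (hμ : ∀ n, n₀ ≤ n → IsProbabilityMeasure (μ n : Measure (X n)) ∧
      ∃ c : ℝ≥0, dualMeasure (rpf hA n) (μ (n + 1)) = c • μ n)
    (hν : ∀ n, n₀ ≤ n → IsProbabilityMeasure (ν n : Measure (X n)) ∧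
      ∃ c : ℝ≥0, dualMeasure (rpf hA n) (ν (n + 1)) = c • ν n) {n : ℤ} (hn : n₀ ≤ n) :
    ν n = μ n := by
  have key : ∀ κ : ∀ n, FiniteMeasure (X n),
      (∀ n, n₀ ≤ n → IsProbabilityMeasure (κ n : Measure (X n)) ∧
        ∃ c : ℝ≥0, dualMeasure (rpf hA n) (κ (n + 1)) = c • κ n) →
      ∀ n, n₀ ≤ n → IsDualPositive hA n (κ n) := by
    intro κ hκ n hn k
    induction k generalizing n with
    | zero =>
      intro m e u hu
      obtain rfl : n = m := by simpa using e
      exact pairing_nonneg hu _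
    | succ k ih =>
      intro m e u hu
      have h1 := ih (n + 1) (by omega) m (by rw [← e]; push_cast; ring) (rpf hA n u) hu
      obtain ⟨hp, c, hc⟩ := hκ n hn
      have hp1 := (hκ (n + 1) (by omega)).1
      -- Testing against `1` shows that the scalar `c` is strictly positive, so the sign passes from
      -- `n + 1` back to `n`.
      have h2 := pairing_pos (rpf_one_pos hA n) (ne_zero_of_isProbabilityMeasure hp1)
      rw [← pairing_dualMeasure, hc, pairing_nnreal_smul] at h1 h2
      rw [pairing_one_eq_one, mul_one] at h2
      exact nonneg_of_mul_nonneg_right h1 h2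
  exact IsDualPositive.eq hc hα1 (hν n hn).1 (hμ n hn).1 (key ν hν n hn) (key μ hμ n hn)

end Conformal

/-! ### Exponential rates for eigenvalues and eigenmeasures. -/

section Forward

variable {X : ℤ → Type*} [∀ n, MetricSpace (X n)] [∀ n, CompactSpace (X n)]
  [∀ n, Nonempty (X n)] [∀ n, MeasurableSpace (X n)] [∀ n, BorelSpace (X n)]
  {T : ∀ n, X n → X (n + 1)} {φ : ∀ n, C(X n, ℝ)} {D : ℕ} {δ ρ : ℝ} {τ : ℕ} {H β V : ℝ}
  {hA : UniformlyExpanding T φ D δ ρ τ H β V}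
  {m : ∀ n, FiniteMeasure (X n)} {lam : ℤ → ℝ} (hm : ConformalFamily hA m lam)

theorem abs_log_sub_log_le {μ x y : ℝ} (hμ : 0 < μ) (hx : μ ≤ x) (hy : μ ≤ y) :
    |Real.log x - Real.log y| ≤ |x - y| / μ := by
  have key : ∀ u v : ℝ, μ ≤ u → μ ≤ v → Real.log u - Real.log v ≤ |u - v| / μ := by
    intro u v hu hv
    have hu0 := hμ.trans_le hu
    have hv0 := hμ.trans_le hv
    rw [← Real.log_div hu0.ne' hv0.ne']
    calc Real.log (u / v) ≤ u / v - 1 := Real.log_le_sub_one_of_pos (div_pos hu0 hv0)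
      _ = (u - v) / v := by field_simp
      _ ≤ |u - v| / v := by gcongr; exact le_abs_self _
      _ ≤ |u - v| / μ := by gcongr
  refine abs_le.2 ⟨?_, key x y hx hy⟩
  have := key y x hy hx
  rw [abs_sub_comm] at this
  linarith

theorem exp_le_rpf_one (hA : UniformlyExpanding T φ D δ ρ τ H β V) (n : ℤ) (x : X (n + 1)) :
    Real.exp (⨅ z, φ n z) ≤ rpf hA n 1 x := by
  obtain ⟨y, rfl⟩ := hA.surjective n x
  simpa using exp_mul_le_rpf hA (zero_le_one (α := C(X n, ℝ))) y

theorem rpf_one_le (hA : UniformlyExpanding T φ D δ ρ τ H β V) (n : ℤ) (x : X (n + 1)) :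
    rpf hA n 1 x ≤ Real.exp (⨅ z, φ n z) * (D * Real.exp V) := by
  simpa using rpf_le hA (f := 1) zero_le_one (fun _ => le_rfl) x

theorem iterRpf_le_of_le {k : ℕ} {n l : ℤ} (e : n + (k : ℤ) = l) {f : C(X n, ℝ)} {M : ℝ}
    (hf : ∀ x, f x ≤ M) (x : X l) : iterRpf hA k n l e f x ≤ M * iterRpf hA k n l e 1 x := by
  have := apply_le_apply (iterRpf hA k n l e) (f := f) (g := M • 1) (by simpa using hf) x
  rwa [map_smul] at this

theorem le_iterRpf_of_le {k : ℕ} {n l : ℤ} (e : n + (k : ℤ) = l) {f : C(X n, ℝ)} {M : ℝ}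
    (hf : ∀ x, M ≤ f x) (x : X l) : M * iterRpf hA k n l e 1 x ≤ iterRpf hA k n l e f x := by
  have := apply_le_apply (iterRpf hA k n l e) (f := M • 1) (g := f) (by simpa using hf) x
  rwa [map_smul] at this

include hm

theorem ConformalFamily.ne_zero (n : ℤ) : m n ≠ 0 :=
  ne_zero_of_isProbabilityMeasure (hm.prob n)

theorem ConformalFamily.pairing_one (n : ℤ) : pairing 1 (m n) = 1 :=
  have := hm.prob n
  pairing_one_eq_one (m n)

theorem ConformalFamily.pairing_rpf (n : ℤ) (f : C(X n, ℝ)) :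
    pairing (rpf hA n f) (m (n + 1)) = lam n * pairing f (m n) := by
  rw [← pairing_dualMeasure, hm.dual, pairing_nnreal_smul, Real.coe_toNNReal _ (hm.lam_pos n).le]

theorem ConformalFamily.prod_pos (k : ℕ) (n : ℤ) : 0 < ∏ j ∈ Finset.range k, lam (n + j) :=
  Finset.prod_pos fun _ _ => hm.lam_pos _

theorem ConformalFamily.pairing_iterRpf (k : ℕ) (n l : ℤ) (e : n + (k : ℤ) = l) (f : C(X n, ℝ)) :
    pairing (iterRpf hA k n l e f) (m l) =
      (∏ j ∈ Finset.range k, lam (n + j)) * pairing f (m n) := by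
  induction k generalizing n with
  | zero =>
    obtain rfl : n = l := by simpa using e
    simp [iterRpf_zero]
  | succ k ih =>
    have e' : n + 1 + (k : ℤ) = l := by rw [← e]; push_cast; ring
    rw [iterRpf_succ hA k n l e e', ih (n + 1) e', hm.pairing_rpf, Finset.prod_range_succ']
    have : ∀ j : ℕ, lam (n + ((j + 1 : ℕ) : ℤ)) = lam (n + 1 + j) := fun j => by
      congr 1; push_cast; ring
    simp only [this, Nat.cast_zero, add_zero]
    ring

/-- The limiting quantity is itself a ratio at time `l`, for the measure `m l`. The rates thus
compare two averages of the same pair of functions. -/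
theorem ConformalFamily.pairing_eq_ratio (k : ℕ) (n l : ℤ) (e : n + (k : ℤ) = l)
    (f : C(X n, ℝ)) : pairing f (m n) =
      pairing (iterRpf hA k n l e f) (m l) / pairing (iterRpf hA k n l e 1) (m l) := by
  have := (hm.prod_pos k n).ne'
  rw [hm.pairing_iterRpf, hm.pairing_iterRpf, hm.pairing_one]
  field_simp

variable {α G Q θ : ℝ} {N : ℕ} (hc : ContractionData hA α G Q θ N)

include hc

/-- Exponential convergence of the ratios defining the eigenvalues and the eigenmeasures. -/
theorem ConformalFamily.exists_rate :
    ∃ C₁ C₂ γ : ℝ, 0 < C₁ ∧ 0 < C₂ ∧ 0 < γ ∧ γ < 1 ∧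
      (∀ (k : ℕ) (n l : ℤ) (e : n + ((k + 1 : ℕ) : ℤ) = l) (e' : n + 1 + (k : ℤ) = l)
        (σ : FiniteMeasure (X l)), σ ≠ 0 →
        |Real.log (lam n) - Real.log (pairing (iterRpf hA (k + 1) n l e 1) σ /
          pairing (iterRpf hA k (n + 1) l e' 1) σ)| ≤ C₁ * γ ^ (k + 1)) ∧
      ∀ (k : ℕ) (n l : ℤ) (e : n + (k : ℤ) = l) (σ : FiniteMeasure (X l)), σ ≠ 0 →
        ∀ f ∈ localCone X (δ / 2) α Q n,
          |pairing f (m n) - pairing (iterRpf hA k n l e f) σ /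
            pairing (iterRpf hA k n l e 1) σ| ≤ C₂ * ‖f‖ * γ ^ k := by
  obtain ⟨C, γ, hC, hγ, hγ1, h⟩ := hc.exists_sandwich
  set E := D * Real.exp V with hE
  have hE1 : 1 ≤ E := hA.one_le_growth
  have hlogE : 0 ≤ Real.log E := Real.log_nonneg hE1
  -- In each constant the first summand serves `k ≥ N`, where the sandwich applies, and the second
  -- serves the finitely many smaller `k`, where trivial bounds suffice.
  refine ⟨C * E / γ + Real.log E / γ ^ N, C + 2 / γ ^ N, γ, by positivity, by positivity,
    hγ, hγ1, ?_, ?_⟩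
  · intro k n l e e' σ hσ
    rw [iterRpf_succ hA k n l e e']
    have hpos : ∀ σ : FiniteMeasure (X l), σ ≠ 0 → 0 < pairing (iterRpf hA k (n + 1) l e' 1) σ :=
      fun σ hσ => pairing_pos (iterRpf_one_pos hA k (n + 1) l e') hσ
    have hlam : lam n = pairing (iterRpf hA k (n + 1) l e' (rpf hA n 1)) (m l) /
        pairing (iterRpf hA k (n + 1) l e' 1) (m l) := by
      rw [← hm.pairing_eq_ratio, hm.pairing_rpf, hm.pairing_one, mul_one]
    set μ := Real.exp (⨅ z, φ n z) with hμ
    have hμ0 : 0 < μ := Real.exp_pos _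
    have hab : ∀ σ : FiniteMeasure (X l), σ ≠ 0 → _ := fun σ hσ =>
      pairing_ratio_mem (a := μ) (b := μ * E)
        (f := iterRpf hA k (n + 1) l e' (rpf hA n 1)) (g := iterRpf hA k (n + 1) l e' 1)
        (fun x => ⟨le_iterRpf_of_le e' (exp_le_rpf_one hA n) x,
          iterRpf_le_of_le e' (rpf_one_le hA n) x⟩) (hpos σ hσ)
    have hab1 := hab σ hσ
    have hab2 := hab (m l) (hm.ne_zero l)
    rw [← hlam] at hab2
    set R := pairing (iterRpf hA k (n + 1) l e' (rpf hA n 1)) σ /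
      pairing (iterRpf hA k (n + 1) l e' 1) σ with hR
    rcases le_or_gt N k with hk | hk
    · obtain ⟨a, -, ha⟩ := h k (n + 1) l e' hk _
        (hc.mem_of_mem (hc.rpf_mem (one_mem_localCone hc.const_pos.le))) 1
        (one_mem_localCone hc.const_pos.le) (μ * E) (by positivity) (by
          obtain ⟨x₀⟩ : Nonempty (X (n + 1 + N)) := inferInstance
          exact ⟨x₀, iterRpf_le_of_le _ (rpf_one_le hA n) x₀⟩)
      have h1 := pairing_ratio_mem ha (hpos σ hσ)
      have h2 := pairing_ratio_mem ha (hpos (m l) (hm.ne_zero l))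
      rw [← hlam] at h2
      rw [← hR] at h1
      have h3 : |lam n - R| ≤ C * (μ * E) * γ ^ k :=
        abs_le.2 ⟨by linarith [h1.2, h2.1], by linarith [h1.1, h2.2]⟩
      calc |Real.log (lam n) - Real.log R| ≤ |lam n - R| / μ :=
            abs_log_sub_log_le hμ0 hab2.1 hab1.1
        _ ≤ C * (μ * E) * γ ^ k / μ := by gcongr
        _ = C * E / γ * γ ^ (k + 1) := by rw [pow_succ]; field_simp
        _ ≤ _ := by
            gcongr
            exact le_add_of_nonneg_right (by positivity)
    · have hlog : ∀ u, μ ≤ u ∧ u ≤ μ * E →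
          Real.log μ ≤ Real.log u ∧ Real.log u ≤ Real.log μ + Real.log E := by
        intro u hu
        refine ⟨Real.log_le_log hμ0 hu.1, ?_⟩
        rw [← Real.log_mul hμ0.ne' (by positivity)]
        exact Real.log_le_log (hμ0.trans_le hu.1) hu.2
      have h1 := hlog _ hab1
      have h2 := hlog _ hab2
      have h3 : |Real.log (lam n) - Real.log R| ≤ Real.log E :=
        abs_le.2 ⟨by linarith [h1.2, h2.1], by linarith [h1.1, h2.2]⟩
      have h4 : γ ^ N ≤ γ ^ (k + 1) := pow_le_pow_of_le_one hγ.le hγ1.le hk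
      calc |Real.log (lam n) - Real.log R| ≤ Real.log E := h3
        _ = Real.log E / γ ^ N * γ ^ N := by field_simp
        _ ≤ Real.log E / γ ^ N * γ ^ (k + 1) := by gcongr
        _ ≤ _ := by
            gcongr
            exact le_add_of_nonneg_left (by positivity)
  · intro k n l e σ hσ f hf
    have hpos : ∀ σ : FiniteMeasure (X l), σ ≠ 0 → 0 < pairing (iterRpf hA k n l e 1) σ :=
      fun σ hσ => pairing_pos (iterRpf_one_pos hA k n l e) hσ
    have hfn : ∀ y, f y ≤ ‖f‖ := fun y => (abs_le.1 (f.norm_coe_le_norm y)).2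
    have hfn' : ∀ y, -‖f‖ ≤ f y := fun y => (abs_le.1 (f.norm_coe_le_norm y)).1
    have hab : ∀ σ : FiniteMeasure (X l), σ ≠ 0 → _ := fun σ hσ =>
      pairing_ratio_mem (a := -‖f‖) (b := ‖f‖)
        (f := iterRpf hA k n l e f) (g := iterRpf hA k n l e 1)
        (fun x => ⟨le_iterRpf_of_le e hfn' x, iterRpf_le_of_le e hfn x⟩) (hpos σ hσ)
    have hab1 := hab σ hσ
    have hab2 := hab (m l) (hm.ne_zero l)
    rw [hm.pairing_eq_ratio k n l e f]
    set R := pairing (iterRpf hA k n l e f) σ / pairing (iterRpf hA k n l e 1) σ with hR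
    set R' := pairing (iterRpf hA k n l e f) (m l) / pairing (iterRpf hA k n l e 1) (m l) with hR'
    rcases le_or_gt N k with hk | hk
    -- The sandwich is used with `B = ‖f‖`, which must be positive.
    · rcases eq_or_ne f 0 with rfl | hf0
      · simp only [norm_zero, neg_zero, mul_zero, zero_mul] at hab1 hab2 ⊢
        exact abs_le.2 ⟨by linarith, by linarith⟩
      · obtain ⟨a, -, ha⟩ := h k n l e hk f hf 1
          (one_mem_localCone hc.const_pos.le) ‖f‖ (norm_pos_iff.2 hf0) (by
            obtain ⟨x₀⟩ : Nonempty (X (n + N)) := inferInstance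
            exact ⟨x₀, iterRpf_le_of_le _ hfn x₀⟩)
        have h1 := pairing_ratio_mem ha (hpos σ hσ)
        have h2 := pairing_ratio_mem ha (hpos (m l) (hm.ne_zero l))
        rw [← hR'] at h2
        rw [← hR] at h1
        calc |R' - R| ≤ C * ‖f‖ * γ ^ k :=
              abs_le.2 ⟨by linarith [h1.2, h2.1], by linarith [h1.1, h2.2]⟩
          _ ≤ _ := by
              gcongr
              exact le_add_of_nonneg_right (by positivity)
    · have h4 : γ ^ N ≤ γ ^ k := pow_le_pow_of_le_one hγ.le hγ1.le hk.le
      calc |R' - R| ≤ 2 * ‖f‖ :=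
            abs_le.2 ⟨by linarith [hab1.2, hab2.1], by linarith [hab1.1, hab2.2]⟩
        _ = 2 / γ ^ N * ‖f‖ * γ ^ N := by field_simp
        _ ≤ 2 / γ ^ N * ‖f‖ * γ ^ k := by gcongr
        _ ≤ _ := by
            gcongr
            exact le_add_of_nonneg_left (by positivity)

theorem ConformalFamily.tendsto_ratio (n : ℤ) (σ : ∀ l, FiniteMeasure (X l))
    (hσ : ∀ l, n ≤ l → σ l ≠ 0) :
    Tendsto (fun k : ℕ =>
      pairing (iterRpf hA (k + 1) n (n + 1 + k) (by push_cast; ring) 1) (σ (n + 1 + k)) /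
        pairing (iterRpf hA k (n + 1) (n + 1 + k) rfl 1) (σ (n + 1 + k)))
      atTop (𝓝 (lam n)) := by
  obtain ⟨C₁, -, γ, -, -, hγ, hγ1, h, -⟩ := hm.exists_rate hc
  have hpos : ∀ k : ℕ, 0 <
      pairing (iterRpf hA (k + 1) n (n + 1 + k) (by push_cast; ring) 1) (σ (n + 1 + k)) /
        pairing (iterRpf hA k (n + 1) (n + 1 + k) rfl 1) (σ (n + 1 + k)) := fun k =>
    div_pos (pairing_pos (iterRpf_one_pos hA _ _ _ _) (hσ _ (by omega)))
      (pairing_pos (iterRpf_one_pos hA _ _ _ _) (hσ _ (by omega)))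
  have hlim : Tendsto (fun k : ℕ => C₁ * γ ^ (k + 1)) atTop (𝓝 0) := by
    simpa using ((tendsto_pow_atTop_nhds_zero_of_lt_one hγ.le hγ1).comp
      (tendsto_add_atTop_nat 1)).const_mul C₁
  have hlog : Tendsto (fun k : ℕ => Real.log
      (pairing (iterRpf hA (k + 1) n (n + 1 + k) (by push_cast; ring) 1) (σ (n + 1 + k)) /
        pairing (iterRpf hA k (n + 1) (n + 1 + k) rfl 1) (σ (n + 1 + k))))
      atTop (𝓝 (Real.log (lam n))) := by
    rw [tendsto_iff_dist_tendsto_zero]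
    refine squeeze_zero (fun _ => dist_nonneg) (fun k => ?_) hlim
    rw [dist_comm, Real.dist_eq]
    exact h k n _ _ rfl _ (hσ _ (by omega))
  have := (Real.continuous_exp.tendsto _).comp hlog
  rw [Real.exp_log (hm.lam_pos n)] at this
  exact this.congr fun k => Real.exp_log (hpos k)

theorem ConformalFamily.tendsto_measure (hα1 : α ≤ 1) (n : ℤ) (σ : ∀ l, FiniteMeasure (X l))
    (hσ : ∀ l, n ≤ l → σ l ≠ 0) :
    Tendsto (fun k : ℕ =>
      (dualMeasure (iterRpf hA k n (n + k) rfl) (σ (n + k))).mass⁻¹ •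
        dualMeasure (iterRpf hA k n (n + k) rfl) (σ (n + k))) atTop (𝓝 (m n)) := by
  obtain ⟨-, C₂, γ, -, -, hγ, hγ1, -, h⟩ := hm.exists_rate hc
  refine tendsto_of_forall_mem_localCone (half_pos hA.delta_pos) hα1 hc.const_pos
    (fun k => isProbabilityMeasure_inv_mass_smul
      (dualMeasure_ne_zero hA rfl (hσ _ (by omega)))) (hm.prob n) fun f hf => ?_
  have hlim : Tendsto (fun k : ℕ => C₂ * ‖f‖ * γ ^ k) atTop (𝓝 0) := by
    simpa using (tendsto_pow_atTop_nhds_zero_of_lt_one hγ.le hγ1).const_mul (C₂ * ‖f‖)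
  rw [tendsto_iff_dist_tendsto_zero]
  refine squeeze_zero (fun _ => dist_nonneg) (fun k => ?_) hlim
  rw [dist_comm, Real.dist_eq, pairing_inv_mass_smul, pairing_dualMeasure, pairing_dualMeasure]
  exact h k n _ rfl _ (hσ _ (by omega)) f hf

end Forward

/-! ### Normalisation to integral one. -/

section Unitize

variable {Y : Type*} [MetricSpace Y] [CompactSpace Y] [MeasurableSpace Y] [BorelSpace Y]

/-- The multiple of `u` whose integral is one. -/
noncomputable def unitize (σ : FiniteMeasure Y) (u : C(Y, ℝ)) : C(Y, ℝ) :=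
  (pairing u σ)⁻¹ • u

theorem unitize_smul (σ : FiniteMeasure Y) (u : C(Y, ℝ)) {c : ℝ} (hc : c ≠ 0) :
    unitize σ (c • u) = unitize σ u := by
  rw [unitize, unitize, pairing_smul, smul_smul]
  congr 1
  field_simp

theorem unitize_of_pairing_eq_one {σ : FiniteMeasure Y} {u : C(Y, ℝ)} (h : pairing u σ = 1) :
    unitize σ u = u := by
  rw [unitize, h, inv_one, one_smul]

theorem pairing_unitize {σ : FiniteMeasure Y} {u : C(Y, ℝ)} (h : pairing u σ ≠ 0) :
    pairing (unitize σ u) σ = 1 := by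
  rw [unitize, pairing_smul, inv_mul_cancel₀ h]

/-- A function of bounded distortion with integral one is bounded above and below. -/
theorem unitize_bounds {σ : FiniteMeasure Y} (hσ : IsProbabilityMeasure (σ : Measure Y))
    {u : C(Y, ℝ)} {K : ℝ} (hu : 0 < pairing u σ)
    (hK : ∀ x x', u x ≤ K * u x') (x : Y) :
    1 ≤ K * unitize σ u x ∧ unitize σ u x ≤ K := by
  have h1 : pairing u σ ≤ K * u x := by
    have := pairing_le_mul (f := u) (g := 1) (a := K * u x) (fun y => by simpa using hK y x) σ
    rwa [pairing_one_eq_one, mul_one] at this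
  have h2 : u x ≤ K * pairing u σ := by
    rw [← pairing_smul]
    have := pairing_mul_le (f := K • u) (g := 1) (a := u x) (fun y => by simpa using hK x y) σ
    rwa [pairing_one_eq_one, mul_one] at this
  have hval : unitize σ u x = u x / pairing u σ := by
    rw [div_eq_inv_mul]; rfl
  rw [hval]
  refine ⟨?_, (div_le_iff₀ hu).2 h2⟩
  rw [← mul_div_assoc]
  exact (one_le_div hu).2 h1

end Unitize

/-! ### Construction of the eigenfunctions. -/

section Eigenfunctions

variable {X : ℤ → Type*} [∀ n, MetricSpace (X n)] [∀ n, CompactSpace (X n)]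
  [∀ n, Nonempty (X n)] [∀ n, MeasurableSpace (X n)] [∀ n, BorelSpace (X n)]
  {T : ∀ n, X n → X (n + 1)} {φ : ∀ n, C(X n, ℝ)} {D : ℕ} {δ ρ : ℝ} {τ : ℕ} {H β V : ℝ}
  {hA : UniformlyExpanding T φ D δ ρ τ H β V}
  {m : ∀ n, FiniteMeasure (X n)} {lam : ℤ → ℝ} (hm : ConformalFamily hA m lam)

theorem tendsto_apply {n : ℤ} {u : ℕ → C(X n, ℝ)} {f : C(X n, ℝ)}
    (hu : Tendsto u atTop (𝓝 f)) (x : X n) : Tendsto (fun k => u k x) atTop (𝓝 (f x)) :=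
  ((continuous_eval_const x).tendsto f).comp hu

theorem iterRpf_congr_source {k : ℕ} {l l' n : ℤ} (hl : l = l') (e : l + (k : ℤ) = n)
    (e' : l' + (k : ℤ) = n) : iterRpf hA k l n e 1 = iterRpf hA k l' n e' 1 := by
  subst hl
  rfl

theorem tendsto_rpf {n : ℤ} {u : ℕ → C(X n, ℝ)} {f : C(X n, ℝ)}
    (hu : Tendsto u atTop (𝓝 f)) (x : X (n + 1)) :
    Tendsto (fun k => rpf hA n (u k) x) atTop (𝓝 (rpf hA n f x)) := by
  simp only [rpf_apply]
  exact tendsto_finsetSum _ fun y _ =>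
    (tendsto_apply hu y).const_mul _

theorem tendsto_pairing {n : ℤ} {u : ℕ → C(X n, ℝ)} {f : C(X n, ℝ)} (σ : FiniteMeasure (X n))
    (hu : Tendsto u atTop (𝓝 f)) : Tendsto (fun k => pairing (u k) σ) atTop (𝓝 (pairing f σ)) := by
  rw [tendsto_iff_dist_tendsto_zero]
  have h := (tendsto_iff_dist_tendsto_zero.1 hu).mul_const (pairing 1 σ)
  rw [zero_mul] at h
  refine squeeze_zero (fun _ => dist_nonneg) (fun k => ?_) h
  rw [Real.dist_eq, ← pairing_sub, dist_eq_norm]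
  exact abs_pairing_le _ σ

include hm

/-- The function may vanish somewhere, but its `N`-th image is strictly positive, and conformality
carries positivity of the integral back. -/
theorem ConformalFamily.pairing_pos_of_mem {α G Q θ : ℝ} {N : ℕ}
    (hc : ContractionData hA α G Q θ N) {n : ℤ} {f : C(X n, ℝ)}
    (hf : f ∈ localCone X (δ / 2) α Q n) (hf0 : f ≠ 0) : 0 < pairing f (m n) := by
  have h := pairing_pos (hc.iterRpf_pos le_rfl rfl hf hf0) (hm.ne_zero (n + N))
  rw [hm.pairing_iterRpf] at h
  exact (pos_iff_pos_of_mul_pos h).1 (hm.prod_pos N n)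

theorem ConformalFamily.pairing_iterRpf_pos {k : ℕ} {n l : ℤ} (e : n + (k : ℤ) = l)
    {f : C(X n, ℝ)} (hf : 0 < pairing f (m n)) : 0 < pairing (iterRpf hA k n l e f) (m l) := by
  rw [hm.pairing_iterRpf]
  exact mul_pos (hm.prod_pos k n) hf

theorem ConformalFamily.unitize_iterRpf {k : ℕ} {n l : ℤ} (e : n + (k : ℤ) = l) (f : C(X n, ℝ)) :
    unitize (m l) (iterRpf hA k n l e f) =
      ((∏ j ∈ Finset.range k, lam (n + j)) * pairing f (m n))⁻¹ • iterRpf hA k n l e f := by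
  rw [unitize, hm.pairing_iterRpf]

theorem ConformalFamily.bounds_unitize_iterRpf {α G Q θ : ℝ} {N : ℕ}
    (hc : ContractionData hA α G Q θ N) {k : ℕ} (hk : N ≤ k) {n l : ℤ} (e : n + (k : ℤ) = l)
    {f : C(X n, ℝ)} (hf : f ∈ localCone X (δ / 2) α Q n) (hf0 : f ≠ 0) (x : X l) :
    1 ≤ distortion D δ V α Q N * unitize (m l) (iterRpf hA k n l e f) x ∧
      unitize (m l) (iterRpf hA k n l e f) x ≤ distortion D δ V α Q N :=
  unitize_bounds (hm.prob l) (hm.pairing_iterRpf_pos e (hm.pairing_pos_of_mem hc hf hf0))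
    (hc.iterRpf_le_mul hk e hf) x

/-- The normalised images of two elements of the cone are exponentially close. -/
theorem ConformalFamily.exists_unitize_rate {α G Q θ : ℝ} {N : ℕ}
    (hc : ContractionData hA α G Q θ N) :
    ∃ C γ : ℝ, 0 < C ∧ 0 < γ ∧ γ < 1 ∧ ∀ (k : ℕ) (n l : ℤ) (e : n + (k : ℤ) = l), N ≤ k →
      ∀ f ∈ localCone X (δ / 2) α Q n, f ≠ 0 → ∀ g ∈ localCone X (δ / 2) α Q n, g ≠ 0 →
        ‖unitize (m l) (iterRpf hA k n l e f) - unitize (m l) (iterRpf hA k n l e g)‖ ≤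
          C * γ ^ k := by
  obtain ⟨C, γ, hC, hγ, hγ1, h⟩ := hc.exists_sandwich
  have hK : 0 < distortion D δ V α Q N := one_pos.trans_le hc.one_le_distortion
  refine ⟨C * distortion D δ V α Q N, γ, by positivity, hγ, hγ1, ?_⟩
  intro k n l e hk f hf hf0 g hg hg0
  -- reduce to functions of integral one
  have hfp := hm.pairing_pos_of_mem hc hf hf0
  have hgp := hm.pairing_pos_of_mem hc hg hg0
  have hred : ∀ u : C(X n, ℝ), 0 < pairing u (m n) →
      unitize (m l) (iterRpf hA k n l e u) =
        (∏ j ∈ Finset.range k, lam (n + j))⁻¹ • iterRpf hA k n l e (unitize (m n) u) := by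
    intro u hu
    rw [hm.unitize_iterRpf, unitize, map_smul, smul_smul, mul_inv]
  have hpf := pairing_unitize hfp.ne'
  have hpg := pairing_unitize hgp.ne'
  -- Equal integrals are preserved by the iterates, so at time `N` one image is at most the other at
  -- some point: the sandwich holds with `B = 1`.
  obtain ⟨a, -, ha⟩ := h k n l e hk _ (localCone_smul_mem hf (inv_nonneg.2 hfp.le))
    _ (localCone_smul_mem hg (inv_nonneg.2 hgp.le)) 1 one_pos (by
      simp only [one_mul]
      refine exists_le_of_pairing_le (hm.prob _) ?_
      rw [hm.pairing_iterRpf, hm.pairing_iterRpf]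
      exact (congrArg _ (hpf.trans hpg.symm)).le)
  change ∀ x, _ * iterRpf hA k n l e (unitize (m n) g) x ≤
    iterRpf hA k n l e (unitize (m n) f) x ∧ iterRpf hA k n l e (unitize (m n) f) x ≤
      _ * iterRpf hA k n l e (unitize (m n) g) x at ha
  have hP := hm.prod_pos k n
  set P := ∏ j ∈ Finset.range k, lam (n + j) with hPdef
  have hpF : pairing (iterRpf hA k n l e (unitize (m n) f)) (m l) = P := by
    rw [hm.pairing_iterRpf, hpf, mul_one]
  have hpG : pairing (iterRpf hA k n l e (unitize (m n) g)) (m l) = P := by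
    rw [hm.pairing_iterRpf, hpg, mul_one]
  -- Integrating the sandwich against `m l`, where both images have integral `P`, locates the
  -- unknown `a` between `1 - C * γ ^ k` and `1`.
  have hratio := pairing_ratio_mem ha (σ := m l) (by rw [hpG]; exact hP)
  rw [hpF, hpG, div_self hP.ne'] at hratio
  refine (ContinuousMap.norm_le _ (by positivity)).2 fun x => ?_
  have hb := (hm.bounds_unitize_iterRpf hc hk e hg hg0 x).2
  rw [hred g hgp] at hb
  rw [hred f hfp, hred g hgp]
  set Fx := iterRpf hA k n l e (unitize (m n) f) x with hFx
  set Gx := iterRpf hA k n l e (unitize (m n) g) x with hGx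
  have hG0 : 0 ≤ Gx :=
    (hc.iterRpf_mem k n l e (localCone_smul_mem hg (inv_nonneg.2 hgp.le))).1 x
  have hax := ha x
  change P⁻¹ * Gx ≤ _ at hb
  change |P⁻¹ * Fx - P⁻¹ * Gx| ≤ _
  have hCγ : 0 ≤ C * γ ^ k := by positivity
  have habs : |Fx - Gx| ≤ C * γ ^ k * Gx := by
    have h1 : (1 - C * γ ^ k) * Gx ≤ a * Gx :=
      mul_le_mul_of_nonneg_right (by linarith [hratio.2]) hG0
    have h2 : (a + C * 1 * γ ^ k) * Gx ≤ (1 + C * γ ^ k) * Gx :=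
      mul_le_mul_of_nonneg_right (by linarith [hratio.1]) hG0
    exact abs_le.2 ⟨by linarith [hax.1], by linarith [hax.2]⟩
  calc |P⁻¹ * Fx - P⁻¹ * Gx| = P⁻¹ * |Fx - Gx| := by
        rw [← mul_sub, abs_mul, abs_of_pos (inv_pos.2 hP)]
    _ ≤ P⁻¹ * (C * γ ^ k * Gx) := by gcongr
    _ = C * γ ^ k * (P⁻¹ * Gx) := by ring
    _ ≤ C * γ ^ k * distortion D δ V α Q N := by gcongr
    _ = _ := by ring

/-- A family that is normalised and invariant up to scalars is reproduced by the normalised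
iterates. -/
theorem ConformalFamily.unitize_iterRpf_eq {g : ∀ n, C(X n, ℝ)}
    (hg : ∀ n, pairing (g n) (m n) = 1) (hL : ∀ n, ∃ c : ℝ, rpf hA n (g n) = c • g (n + 1))
    {k : ℕ} {n l : ℤ} (e : n + (k : ℤ) = l) :
    unitize (m l) (iterRpf hA k n l e (g n)) = g l := by
  have hex : ∃ c : ℝ, iterRpf hA k n l e (g n) = c • g l := by
    induction k generalizing n with
    | zero =>
      obtain rfl : n = l := by simpa using e
      exact ⟨1, by rw [one_smul, iterRpf_zero]⟩
    | succ k ih =>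
      obtain ⟨c, hc⟩ := hL n
      have e' : n + 1 + (k : ℤ) = l := by rw [← e]; push_cast; ring
      obtain ⟨c', hc'⟩ := ih e'
      exact ⟨c * c', by rw [iterRpf_succ hA k n l e e', hc, map_smul, hc', smul_smul]⟩
  obtain ⟨c, hc⟩ := hex
  have h1 := hm.pairing_iterRpf_pos e (f := g n) (by rw [hg]; exact one_pos)
  have hc0 : c ≠ 0 := by
    rintro rfl
    rw [hc, pairing_smul, zero_mul] at h1
    exact lt_irrefl _ h1
  rw [hc, unitize_smul _ _ hc0, unitize_of_pairing_eq_one (hg l)]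

/-- The normalised iterates of the constant function converge. -/
theorem ConformalFamily.exists_limit {α G Q θ : ℝ} {N : ℕ}
    (hc : ContractionData hA α G Q θ N) (n : ℤ) :
    ∃ h : C(X n, ℝ), Tendsto (fun k : ℕ =>
      unitize (m n) (iterRpf hA k (n - k) n (by ring) 1)) atTop (𝓝 h) := by
  obtain ⟨C, γ, hC, hγ, hγ1, h⟩ := hm.exists_unitize_rate hc
  set u : ℕ → C(X n, ℝ) := fun k => unitize (m n) (iterRpf hA k (n - k) n (by ring) 1) with hu
  have hone : ∀ l : ℤ, (1 : C(X l, ℝ)) ∈ localCone X (δ / 2) α Q l := fun l =>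
    one_mem_localCone hc.const_pos.le
  have hstep : ∀ k, N ≤ k → dist (u k) (u (k + 1)) ≤ C * γ ^ k := by
    intro k hk
    rw [dist_eq_norm]
    have e₁ : n - ((k + 1 : ℕ) : ℤ) + ((1 : ℕ) : ℤ) = n - k := by push_cast; ring
    have e₂ : n - (k : ℤ) + (k : ℤ) = n := by ring
    -- Consecutive terms start one level apart; absorbing the first step of the longer iterate makes
    -- both `k`-step images from level `n - k`.
    have h1 : u (k + 1) = unitize (m n) (iterRpf hA k (n - k) n e₂
        (iterRpf hA 1 (n - ((k + 1 : ℕ) : ℤ)) (n - k) e₁ 1)) := by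
      rw [hu, ← iterRpf_add hA 1 k (k + 1) (by ring) (n - ((k + 1 : ℕ) : ℤ)) (n - k) n e₁ e₂]
    rw [h1]
    refine h k (n - k) n e₂ hk 1 (hone _) one_ne_zero _
      (hc.iterRpf_mem 1 _ _ e₁ (hone _)) ?_
    intro h0
    obtain ⟨x⟩ : Nonempty (X (n - k)) := inferInstance
    have h2 := iterRpf_one_pos hA 1 _ _ e₁ x
    rw [h0] at h2
    exact lt_irrefl _ h2
  have hcauchy : CauchySeq (fun k => u (k + N)) := by
    refine cauchySeq_of_le_geometric γ C hγ1 fun k => ?_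
    have h1 := hstep (k + N) (by omega)
    rw [show k + 1 + N = k + N + 1 by ring]
    refine h1.trans (mul_le_mul_of_nonneg_left ?_ hC.le)
    exact pow_le_pow_of_le_one hγ.le hγ1.le (by omega)
  obtain ⟨f, hf⟩ := cauchySeq_tendsto_of_complete hcauchy
  exact ⟨f, (tendsto_add_atTop_iff_nat N).1 hf⟩

section Limit

variable {h : ∀ n, C(X n, ℝ)} (hlim : ∀ n : ℤ, Tendsto (fun k : ℕ =>
  unitize (m n) (iterRpf hA k (n - k) n (by ring) 1)) atTop (𝓝 (h n)))

include hlim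

theorem ConformalFamily.pairing_limit (n : ℤ) : pairing (h n) (m n) = 1 := by
  refine tendsto_nhds_unique (tendsto_pairing (m n) (hlim n)) ?_
  refine tendsto_const_nhds.congr fun k => (pairing_unitize ?_).symm
  exact (hm.pairing_iterRpf_pos _ (by rw [hm.pairing_one]; exact one_pos)).ne'

theorem ConformalFamily.rpf_limit (n : ℤ) : rpf hA n (h n) = lam n • h (n + 1) := by
  ext x
  refine tendsto_nhds_unique (tendsto_rpf (hlim n) x) ?_
  -- The image of the `k`-th approximant at `n` is `lam n` times the `(k + 1)`-st approximant at `n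
  -- + 1`.
  have h1 : Tendsto (fun k : ℕ => lam n * unitize (m (n + 1))
      (iterRpf hA (k + 1) (n + 1 - ((k + 1 : ℕ) : ℤ)) (n + 1) (by ring) 1) x) atTop
      (𝓝 (lam n * h (n + 1) x)) :=
    (tendsto_apply ((hlim (n + 1)).comp (tendsto_add_atTop_nat 1)) x).const_mul _
  refine h1.congr fun k => ?_
  have e₁ : n - (k : ℤ) + ((k + 1 : ℕ) : ℤ) = n + 1 := by push_cast; ring
  rw [iterRpf_congr_source (l' := n - k) (by push_cast; ring) _ e₁,
    iterRpf_succ' hA k (n - k) n e₁ (by ring), unitize, unitize, hm.pairing_rpf, map_smul]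
  simp only [ContinuousMap.smul_apply, smul_eq_mul, mul_inv]
  have := (hm.lam_pos n).ne'
  field_simp

/-- The contraction data need not be those that produced the limit: convergence obtained with
exponent `min β 1` also yields regularity with exponent `β`. -/
theorem ConformalFamily.limit_mem {α G Q θ : ℝ} {N : ℕ} (hc : ContractionData hA α G Q θ N)
    (n : ℤ) : h n ∈ localCone X (δ / 2) α Q n := by
  refine localCone_of_tendsto (Eventually.of_forall fun k => ?_) fun x => tendsto_apply (hlim n) x
  have h1 := hc.iterRpf_mem k (n - k) n (by ring) (one_mem_localCone hc.const_pos.le)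
  exact localCone_smul_mem h1 (inv_nonneg.2 (pairing_nonneg h1.1 _))

theorem ConformalFamily.limit_bounds {α G Q θ : ℝ} {N : ℕ} (hc : ContractionData hA α G Q θ N)
    (n : ℤ) (x : X n) :
    1 ≤ distortion D δ V α Q N * h n x ∧ h n x ≤ distortion D δ V α Q N := by
  have h1 := tendsto_apply (hlim n) x
  have h2 : ∀ᶠ k : ℕ in atTop, _ := (eventually_ge_atTop N).mono fun k hk =>
    hm.bounds_unitize_iterRpf hc hk (n := n - k) (by ring)
      (one_mem_localCone hc.const_pos.le) one_ne_zero x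
  exact ⟨ge_of_tendsto (h1.const_mul _) (h2.mono fun _ hk => hk.1),
    le_of_tendsto h1 (h2.mono fun _ hk => hk.2)⟩

/-- Passing to the limit in the distortion bound costs one factor of the distortion, whereas
combining the two bounds of `limit_bounds` would cost two. -/
theorem ConformalFamily.limit_le_mul {α G Q θ : ℝ} {N : ℕ} (hc : ContractionData hA α G Q θ N)
    (n : ℤ) (x x' : X n) : h n x ≤ distortion D δ V α Q N * h n x' := by
  have h1 := tendsto_apply (hlim n) x
  have h2 := tendsto_apply (hlim n) x'
  refine le_of_tendsto_of_tendsto h1 (h2.const_mul _) ?_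
  filter_upwards [eventually_ge_atTop N] with k hk
  have h3 := hc.iterRpf_le_mul hk (n := n - k) (m := n) (by ring)
    (one_mem_localCone hc.const_pos.le) x x'
  have h4 := mul_le_mul_of_nonneg_left h3 (inv_nonneg.2 (pairing_nonneg
    (hc.iterRpf_mem k (n - k) n (by ring) (one_mem_localCone hc.const_pos.le)).1 (m n)))
  simp only [unitize, ContinuousMap.smul_apply, smul_eq_mul]
  linarith

end Limit

end Eigenfunctions

/-! ### Choice of constants and comparison with the cones of the theorem. -/

section Cone

variable {X : ℤ → Type*} [∀ n, MetricSpace (X n)] [∀ n, CompactSpace (X n)]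
  [∀ n, Nonempty (X n)] [∀ n, MeasurableSpace (X n)] [∀ n, BorelSpace (X n)]
  {T : ∀ n, X n → X (n + 1)} {φ : ∀ n, C(X n, ℝ)} {D : ℕ} {δ ρ : ℝ} {τ : ℕ} {H β V : ℝ}
  (hA : UniformlyExpanding T φ D δ ρ τ H β V)

theorem exists_contractionData {α G : ℝ} (hα : 0 < α) (hG : 0 ≤ G)
    (hφ : ∀ n (x x' : X n), dist x x' ≤ δ → |φ n x - φ n x'| ≤ G * dist x x' ^ α) {N : ℕ}
    (hN : 0 < N) (hex : ∀ (n m : ℤ) (e : n + (N : ℤ) = m) (x : X n),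
      iterMap T N n m e '' Metric.ball x (δ / 2) = Set.univ) :
    ∃ Q₀ θ : ℝ, 0 < Q₀ ∧ ∀ Q, Q₀ ≤ Q → ContractionData hA α G Q θ N := by
  have h0 : 0 < ρ ^ α := Real.rpow_pos_of_pos hA.rho_pos _
  have h1 : ρ ^ α < 1 := Real.rpow_lt_one hA.rho_pos.le hA.rho_lt_one hα
  have h1' : 0 < 1 - ρ ^ α := by linarith
  have hQ₀ : 0 < 2 * ρ ^ α * G / (1 - ρ ^ α) + 1 := by positivity
  -- With `θ` midway between `ρ ^ α` and `1`, the contraction condition reads `2 * ρ ^ α * G ≤ (1 -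
  -- ρ ^ α) * Q`. The summand `1` keeps the threshold positive when `G = 0`.
  refine ⟨2 * ρ ^ α * G / (1 - ρ ^ α) + 1, (1 + ρ ^ α) / 2, hQ₀, fun Q hQ => ?_⟩
  refine ⟨hα, hG, hφ, hQ₀.trans_le hQ, by positivity, by linarith, ?_, hN, hex⟩
  have h2 : 2 * ρ ^ α * G / (1 - ρ ^ α) ≤ Q := by linarith
  rw [div_le_iff₀ h1'] at h2
  linarith

theorem rpow_le_mul_rpow {d α : ℝ} (hd : 0 ≤ d) (hdδ : d ≤ δ) (hα : 0 < α) (hαβ : α ≤ β) :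
    d ^ β ≤ δ ^ (β - α) * d ^ α := by
  have h1 : d ^ β = d ^ (β - α) * d ^ α := by
    rw [← Real.rpow_add_of_nonneg hd (by linarith) hα.le]
    congr 1; ring
  rw [h1]
  exact mul_le_mul_of_nonneg_right (Real.rpow_le_rpow hd hdδ (by linarith))
    (Real.rpow_nonneg hd _)

include hA in
theorem UniformlyExpanding.holder_of_le {α : ℝ} (hα : 0 < α) (hαβ : α ≤ β) (n : ℤ) (x x' : X n)
    (hx : dist x x' ≤ δ) : |φ n x - φ n x'| ≤ H * δ ^ (β - α) * dist x x' ^ α := by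
  refine (hA.holder n x x' hx).trans ?_
  rw [mul_assoc]
  exact mul_le_mul_of_nonneg_left (rpow_le_mul_rpow dist_nonneg hx hα hαβ) hA.holder_const_pos.le

include hA in
theorem mem_localCone_of_mem_rpfCone {α Q Q' : ℝ} (hα : 0 < α) (hαβ : α ≤ β) (hQ : 0 ≤ Q)
    (hQ' : Q * δ ^ (β - α) ≤ Q') {n : ℤ} {f : C(X n, ℝ)} (hf : f ∈ rpfCone X δ β Q n) :
    f ∈ localCone X (δ / 2) α Q' n := by
  refine localCone_mono hQ' ⟨hf.1, fun x x' hx => ?_⟩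
  have hx' : dist x x' ≤ δ := by linarith [hA.delta_pos]
  refine (hf.2.2 x x' hx').trans (mul_le_mul_of_nonneg_right (Real.exp_le_exp.2 ?_) (hf.1 x'))
  rw [mul_assoc]
  exact mul_le_mul_of_nonneg_left (rpow_le_mul_rpow dist_nonneg hx' hα hαβ) hQ

variable {hA} {m : ∀ n, FiniteMeasure (X n)} {lam : ℤ → ℝ} (hm : ConformalFamily hA m lam)

include hm

/-- Uniform bound for the normalised images of the cone after at least `τ` steps. -/
theorem ConformalFamily.bounds_of_mem_rpfCone {Q : ℝ} (hQ : 0 ≤ Q) {k : ℕ} (hk : τ ≤ k) {n l : ℤ}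
    (e : n + (k : ℤ) = l) {f : C(X n, ℝ)} (hf : f ∈ rpfCone X δ β Q n)
    (hfm : 0 < pairing f (m n)) (x : X l) :
    0 ≤ unitize (m l) (iterRpf hA k n l e f) x ∧
      unitize (m l) (iterRpf hA k n l e f) x ≤
        (D * Real.exp V) ^ k * Real.exp (Q * δ ^ β) := by
  have hpos := hm.pairing_iterRpf_pos e hfm
  refine ⟨mul_nonneg (inv_nonneg.2 hpos.le) (PositiveLinearMap.apply_nonneg _ hf.1 x),
    (unitize_bounds (hm.prob l) hpos ?_ x).2⟩
  refine iterRpf_le_mul_of_exact hA e (hA.image_iterMap_eq_univ hk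
    (fun n m e x => hA.image_iterMap_ball e x) e) hf.1 (Real.exp_pos _).le fun z y hy => ?_
  have hy : dist z y < δ := by rw [dist_comm]; exact hy
  refine (hf.2.2 z y hy.le).trans (mul_le_mul_of_nonneg_right (Real.exp_le_exp.2 ?_) (hf.1 y))
  exact mul_le_mul_of_nonneg_left
    (Real.rpow_le_rpow dist_nonneg hy.le hA.holder_exp_pos.le) hQ

end Cone

end NonstatRPF

/-! ### The theorem. -/

theorem theorem2 {X : ℤ → Type*} [∀ n, MetricSpace (X n)] [∀ n, CompactSpace (X n)]
    [∀ n, Nonempty (X n)] [∀ n, MeasurableSpace (X n)] [∀ n, BorelSpace (X n)]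
    (T : ∀ n, X n → X (n + 1)) (φ : ∀ n, C(X n, ℝ))
    (D : ℕ) (δ ρ : ℝ) (τ : ℕ) (H β V : ℝ)
    (hA : UniformlyExpanding T φ D δ ρ τ H β V) :
    ∃ Q₀ : ℝ, 0 < Q₀ ∧ ∀ Q : ℝ, Q₀ ≤ Q →
      ∃ (lam : ℤ → ℝ) (m : ∀ n, FiniteMeasure (X n)) (h : ∀ n, C(X n, ℝ)),
        -- [A] the limits defining the eigenvalues and the eigenmeasures
        (∀ (n : ℤ) (σ : ∀ l, FiniteMeasure (X l)), (∀ l, n ≤ l → σ l ≠ 0) →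
          Tendsto (fun k : ℕ =>
              pairing (iterRpf hA (k + 1) n (n + 1 + k) (by push_cast; ring) 1) (σ (n + 1 + k)) /
                pairing (iterRpf hA k (n + 1) (n + 1 + k) rfl 1) (σ (n + 1 + k)))
            atTop (𝓝 (lam n)) ∧
          Tendsto (fun k : ℕ =>
              (dualMeasure (iterRpf hA k n (n + k) rfl) (σ (n + k))).mass⁻¹ •
                dualMeasure (iterRpf hA k n (n + k) rfl) (σ (n + k)))
            atTop (𝓝 (m n))) ∧
        -- [B] positivity, normalization and the eigenmeasure equation
        (∀ n, 0 < lam n ∧ IsProbabilityMeasure (m n : Measure (X n)) ∧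
          dualMeasure (rpf hA n) (m (n + 1)) = (lam n).toNNReal • m n) ∧
        -- [C] uniqueness of the eigenmeasures, already along every forward half-line
        (∀ (N : ℤ) (ν : ∀ n, FiniteMeasure (X n)),
          (∀ n, N ≤ n → IsProbabilityMeasure (ν n : Measure (X n)) ∧
            ∃ c : ℝ≥0, dualMeasure (rpf hA n) (ν (n + 1)) = c • ν n) →
          ∀ n, N ≤ n → ν n = m n) ∧
        -- [D] uniformly exponential convergence in [A], with `k + 1 ≥ τ` forward steps
        (∃ C₁ C₂ γ : ℝ, 0 < C₁ ∧ 0 < C₂ ∧ 0 < γ ∧ γ < 1 ∧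
          ∀ (n : ℤ) (k : ℕ), τ ≤ k + 1 → ∀ σ : FiniteMeasure (X (n + 1 + k)), σ ≠ 0 →
            ∀ f ∈ rpfCone X δ β Q n,
              |Real.log (lam n) - Real.log
                (pairing (iterRpf hA (k + 1) n (n + 1 + k) (by push_cast; ring) 1) σ /
                  pairing (iterRpf hA k (n + 1) (n + 1 + k) rfl 1) σ)| ≤ C₁ * γ ^ (k + 1) ∧
              |pairing f (m n) -
                pairing f (dualMeasure
                    (iterRpf hA (k + 1) n (n + 1 + k) (by push_cast; ring)) σ) /
                  pairing 1 (dualMeasure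
                    (iterRpf hA (k + 1) n (n + 1 + k) (by push_cast; ring)) σ)|
                ≤ C₂ * ‖f‖ * γ ^ (k + 1)) ∧
        -- [E] the limit defining the eigenfunctions
        (∀ (n : ℤ) (f : ∀ l, C(X l, ℝ)), (∀ l, l ≤ n → f l ∈ rpfCone X δ β Q l) →
          Tendsto (fun k : ℕ =>
              ((∏ j ∈ Finset.range k, lam (n - k + j)) * pairing (f (n - k)) (m (n - k)))⁻¹ •
                iterRpf hA k (n - k) n (by ring) (f (n - k)))
            atTop (𝓝 (h n))) ∧
        -- [F] positivity, regularity, normalization and the eigenfunction equation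
        (∀ n, (∀ x, 0 < h n x) ∧ h n ∈ rpfCone X δ β Q n ∧ pairing (h n) (m n) = 1 ∧
          rpf hA n (h n) = lam n • h (n + 1)) ∧
        -- [G] uniqueness of the eigenfunctions
        (∀ g : ∀ n, C(X n, ℝ), (∀ n, g n ∈ rpfCone X δ β Q n) →
          (∀ n, pairing (g n) (m n) = 1) →
          (∀ n, ∃ c : ℝ, rpf hA n (g n) = c • g (n + 1)) →
          ∀ n, g n = h n) ∧
        -- [H] uniformly exponential convergence in [E]
        (∃ C₃ γ : ℝ, 0 < C₃ ∧ 0 < γ ∧ γ < 1 ∧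
          ∀ (n : ℤ) (k : ℕ), τ ≤ k → ∀ f ∈ rpfCone X δ β Q (n - k),
            ‖h n - ((∏ j ∈ Finset.range k, lam (n - k + j)) * pairing f (m (n - k)))⁻¹ •
                iterRpf hA k (n - k) n (by ring) f‖ ≤ C₃ * γ ^ k) := by
  obtain ⟨N, hN, hex⟩ : ∃ N : ℕ, 0 < N ∧
      ∀ (n m : ℤ) (e : n + (N : ℤ) = m) (x : X n),
        iterMap T N n m e '' Metric.ball x (δ / 2) = Set.univ := by
    obtain ⟨N, hN⟩ := hA.exists_exact_time (half_pos hA.delta_pos)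
    exact ⟨max τ N, hA.tau_pos.trans_le (le_max_left _ _), fun n m e x =>
      hA.image_iterMap_eq_univ (le_max_right _ _) hN e x⟩
  have hδ := hA.delta_pos
  set α := min β 1 with hα
  have hα0 : 0 < α := lt_min hA.holder_exp_pos one_pos
  have hα1 : α ≤ 1 := min_le_right _ _
  have hαβ : α ≤ β := min_le_left _ _
  have hδα : 0 < δ ^ (β - α) := Real.rpow_pos_of_pos hδ _
  obtain ⟨Qa, θ, hQa, hdata⟩ := exists_contractionData hA hα0
    (mul_nonneg hA.holder_const_pos.le hδα.le) (hA.holder_of_le hα0 hαβ) hN hex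
  -- Exponent `α` serves for convergence and measures; exponent `β` is needed only for the
  -- regularity of `h`.
  obtain ⟨Qb, θb, hQb, hdatab⟩ := exists_contractionData hA hA.holder_exp_pos
    hA.holder_const_pos.le hA.holder hN hex
  have hc := hdata Qa le_rfl
  have hcb := hdatab Qb le_rfl
  obtain ⟨m, lam, hm⟩ := exists_conformalFamily hc hα1
  choose h hlim using hm.exists_limit hc
  have hK := hc.one_le_distortion
  set K := distortion D δ V α Qa N with hKdef
  have hK0 : 0 < K := one_pos.trans_le hK
  have hhpos : ∀ n x, 0 < h n x := fun n x =>
    pos_of_mul_pos_right (one_pos.trans_le (hm.limit_bounds hlim hc n x).1) hK0.le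
  have hhne : ∀ n, h n ≠ 0 := fun n h0 => by
    obtain ⟨x⟩ : Nonempty (X n) := inferInstance
    have := hhpos n x
    rw [h0] at this
    exact lt_irrefl _ this
  have hhint := hm.pairing_limit hlim
  have hhrpf := hm.rpf_limit hlim
  have hδβ : 0 < (δ / 2) ^ β := Real.rpow_pos_of_pos (half_pos hδ) _
  -- The first threshold puts `h` in the cone at distances below `δ / 2`; the second makes `exp (Q *
  -- d ^ β)` at least the distortion `K` at distances `d` from `δ / 2` to `δ`. The objects `lam`,
  -- `m`, `h` are already fixed, so they do not depend on `Q`.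
  refine ⟨max Qb (Real.log K / (δ / 2) ^ β), lt_max_of_lt_left hQb, fun Q hQ => ?_⟩
  have hQb' : Qb ≤ Q := (le_max_left _ _).trans hQ
  have hQ0 : 0 < Q := hQb.trans_le hQb'
  have hQK : Real.log K ≤ Q * (δ / 2) ^ β := (div_le_iff₀ hδβ).1 ((le_max_right _ _).trans hQ)
  -- The working cone is enlarged with `Q` so as to contain the theorem's cone.
  set Qc := max Qa (Q * δ ^ (β - α)) with hQc
  have hcc := hdata Qc (le_max_left _ _)
  have hsub : ∀ n, ∀ f ∈ rpfCone X δ β Q n, f ∈ localCone X (δ / 2) α Qc n := fun n f hf =>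
    mem_localCone_of_mem_rpfCone hA hα0 hαβ hQ0.le (le_max_right _ _) hf
  have hfpos : ∀ n, ∀ f ∈ rpfCone X δ β Q n, 0 < pairing f (m n) := fun n f hf =>
    hm.pairing_pos_of_mem hcc (hsub n f hf) hf.2.1
  have hhΛ : ∀ n, h n ∈ rpfCone X δ β Q n := by
    intro n
    refine ⟨fun x => (hhpos n x).le, hhne n, fun x x' hx => ?_⟩
    rcases lt_or_ge (dist x x') (δ / 2) with hd | hd
    · exact (localCone_mono hQb' (hm.limit_mem hlim hcb n)).2 x x' hd
    · refine (hm.limit_le_mul hlim hc n x x').trans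
        (mul_le_mul_of_nonneg_right ?_ (hhpos n x').le)
      rw [← Real.log_le_iff_le_exp hK0]
      exact hQK.trans (mul_le_mul_of_nonneg_left
        (Real.rpow_le_rpow (half_pos hδ).le hd hA.holder_exp_pos.le) hQ0.le)
  obtain ⟨C, γ, hC, hγ, hγ1, hrate⟩ := hm.exists_unitize_rate hcc
  -- Stated for an arbitrary normalised invariant family `g`: with `g = h` it gives [E] and [H], and
  -- comparing `g` with `h` gives [G].
  have hreg : ∀ g : ∀ n, C(X n, ℝ), (∀ n, g n ∈ rpfCone X δ β Q n) →
      (∀ n, pairing (g n) (m n) = 1) →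
      (∀ n, ∃ c : ℝ, rpf hA n (g n) = c • g (n + 1)) →
      ∀ (k : ℕ) (n l : ℤ) (e : n + (k : ℤ) = l), N ≤ k → ∀ f ∈ rpfCone X δ β Q n,
        ‖g l - unitize (m l) (iterRpf hA k n l e f)‖ ≤ C * γ ^ k := by
    intro g hgΛ hgint hgL k n l e hk f hf
    rw [← hm.unitize_iterRpf_eq hgint hgL e]
    exact hrate k n l e hk _ (hsub n _ (hgΛ n)) (hgΛ n).2.1 f (hsub n f hf) hf.2.1
  have hconv : ∀ g : ∀ n, C(X n, ℝ), (∀ n, g n ∈ rpfCone X δ β Q n) →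
      (∀ n, pairing (g n) (m n) = 1) →
      (∀ n, ∃ c : ℝ, rpf hA n (g n) = c • g (n + 1)) →
      ∀ (n : ℤ) (f : ∀ l, C(X l, ℝ)), (∀ l, l ≤ n → f l ∈ rpfCone X δ β Q l) →
        Tendsto (fun k : ℕ => unitize (m n) (iterRpf hA k (n - k) n (by ring) (f (n - k))))
          atTop (𝓝 (g n)) := by
    intro g hgΛ hgint hgL n f hf
    have hzero : Tendsto (fun k : ℕ => C * γ ^ k) atTop (𝓝 0) := by
      simpa using (tendsto_pow_atTop_nhds_zero_of_lt_one hγ.le hγ1).const_mul C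
    rw [tendsto_iff_dist_tendsto_zero]
    refine squeeze_zero' (Eventually.of_forall fun _ => dist_nonneg) ?_ hzero
    filter_upwards [eventually_ge_atTop N] with k hk
    rw [dist_comm, dist_eq_norm]
    exact hreg g hgΛ hgint hgL k _ _ _ hk _ (hf _ (by omega))
  have hhL : ∀ n, ∃ c : ℝ, rpf hA n (h n) = c • h (n + 1) := fun n => ⟨_, hhrpf n⟩
  refine ⟨lam, m, h, fun n σ hσ => ⟨hm.tendsto_ratio hc n σ hσ,
    hm.tendsto_measure hc hα1 n σ hσ⟩, fun n => ⟨hm.lam_pos n, hm.prob n, hm.dual n⟩, ?_, ?_, ?_,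
    fun n => ⟨hhpos n, hhΛ n, hhint n, hhrpf n⟩, ?_, ?_⟩
  · intro n₀ ν hν n hn
    exact ConformalFamily.eq_of_forward hc hα1
      (fun n _ => ⟨hm.prob n, _, hm.dual n⟩) hν hn
  · obtain ⟨C₁, C₂, γ', hC₁, hC₂, hγ', hγ1', h1, h2⟩ := hm.exists_rate hcc
    refine ⟨C₁, C₂, γ', hC₁, hC₂, hγ', hγ1', fun n k _ σ hσ f hf => ⟨h1 k n _ _ rfl σ hσ, ?_⟩⟩
    rw [pairing_dualMeasure, pairing_dualMeasure]
    exact h2 (k + 1) n _ _ σ hσ f (hsub n f hf)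
  · intro n f hf
    simp only [← hm.unitize_iterRpf]
    exact hconv h hhΛ hhint hhL n f hf
  · intro g hgΛ hgint hgL n
    exact tendsto_nhds_unique (hconv g hgΛ hgint hgL n h fun l _ => hhΛ l)
      (hconv h hhΛ hhint hhL n h fun l _ => hhΛ l)
  · set E := D * Real.exp V with hE
    have hE1 : 1 ≤ E := hA.one_le_growth
    set B := K + E ^ N * Real.exp (Q * δ ^ β) with hB
    have hB0 : 0 < B := by positivity
    refine ⟨C + B / γ ^ N, γ, by positivity, hγ, hγ1, fun n k hk f hf => ?_⟩
    rw [← hm.unitize_iterRpf]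
    rcases le_or_gt N k with hNk | hNk
    · refine (hreg h hhΛ hhint hhL k _ _ _ hNk f hf).trans ?_
      gcongr
      exact le_add_of_nonneg_right (by positivity)
    -- For `τ ≤ k < N` the cone estimates are not available; exactness at scale `δ` still bounds the
    -- normalised iterates uniformly, and the factor `γ ^ N` absorbs the missing decay.
    · calc _ ≤ B := by
            refine (ContinuousMap.norm_le _ hB0.le).2 fun x => ?_
            have h1 := hm.bounds_of_mem_rpfCone hQ0.le hk (n := n - k) (l := n) (by ring) hf
              (hfpos _ f hf) x
            have h2 := hhpos n x
            have h3 := (hm.limit_bounds hlim hc n x).2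
            have h4 : E ^ k * Real.exp (Q * δ ^ β) ≤ E ^ N * Real.exp (Q * δ ^ β) := by
              gcongr
            have h5 : 0 < E ^ N * Real.exp (Q * δ ^ β) := by positivity
            rw [Real.norm_eq_abs, ContinuousMap.sub_apply, hB]
            exact abs_le.2 ⟨by linarith [h1.2], by linarith [h1.1]⟩
        _ = B / γ ^ N * γ ^ N := by field_simp
        _ ≤ B / γ ^ N * γ ^ k := by
            gcongr ?_ * ?_
            exact pow_le_pow_of_le_one hγ.le hγ1.le hNk.le
        _ ≤ _ := by
            gcongr
            exact le_add_of_nonneg_left hC.le
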